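/- Let $(\mathbb A,W)$ be a $2$-dimensional model flat: a $2$-dimensional Euclidean vector space with a finite group $W$ of linear isometries generated by reflections and fixing no nonzero vector. A vector of $\mathbb A$ is singular if it is fixed by a reflection of $W$, and regular otherwise. Let $\mathfrak C\subset\mathbb A$ be a Weyl chamber, i.e. a connected component of the set of regular vectors, with closure $\overline{\mathfrak C}$, and let $W_{\mathrm{aff}}$ be the group of all affine isomorphisms of $\mathbb A$ with linear part in $W$. Let $\mathcal E$ be a Euclidean building modelled on $(\mathbb A,W)$, not necessarily discrete, locally compact or complete: a CAT(0) metric space with a nonempty collection of isometric embeddings $f:\mathbb A\to\mathcal E$, called marked flats, such that the collection is invariant under precomposition by $W_{\mathrm{aff}}$; all transition maps $f'^{-1}\circ f$ are restrictions of elements of $W_{\mathrm{aff}}$; and the initial parts of any two nontrivial geodesics of $\mathcal E$ are contained in a common marked flat. A segment of $\mathcal E$ is singular if it is $[f(a),f(b)]$ for some marked flat $f$ and $a,b\in\mathbb A$ with $b-a$ singular. For $y\ne x$ in $\mathcal E$, let $\Sigma_xy$ be the direction at $x$ (the germ at $x$) of the segment $[x,y]$. The closed chambers of the space of directions $\Sigma_x\mathcal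 E$ are the germs at $x$ of the sets $f(\overline{\mathfrak C})$, for $f$ a marked flat with $f(0)=x$; two of them are opposite if, for some marked flat $f$ with $f(0)=x$, they are the germs at $x$ of $f(\overline{\mathfrak C})$ and $f(-\overline{\mathfrak C})$. Two directions at $x$ are $\mathfrak C$-opposite if they are contained in opposite closed chambers of $\Sigma_x\mathcal E$. A piecewise affine path $\gamma:[s,s']\to\mathcal E$ is a $\mathfrak C$-geodesic if $\gamma=f\circ\eta$ for a marked flat $f$ and a piecewise affine path $\eta:[s,s']\to\mathbb A$ with $\dot\eta(t)\in\overline{\mathfrak C}$ for almost every $t$. A finite or infinite sequence $(x_p)$ in $\mathcal E$, indexed by consecutive integers, is $\mathfrak C$-geodesic if each piecewise affine path with finitely many consecutive vertices $x_m,x_{m+1},\dots,x_n$ of the sequence is a $\mathfrak C$-geodesic (for a finite sequence: if the whole path is one). Let $(x_p)$ be a finite or infinite sequence of points of $\mathcal E$, indexed by consecutive integers, such that $x_p\notin[x_{p-1},x_{p+1}]$ for all $p$ for which $x_{p-1}$ and $x_{p+1}$ are defined. Suppose that: 1. for all $p$ for which $x_{p-1},x_{p+1}$ are defined, the directions $\Sigma_{x_p}x_{p-1}$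 and $\Sigma_{x_p}x_{p+1}$ are $\mathfrak C$-opposite; 2. for all $p$ for which $x_{p-2},x_{p+1}$ are defined and $[x_{p-1},x_p]$ is singular, the directions $\Sigma_{x_p}x_{p-2}$ and $\Sigma_{x_p}x_{p+1}$ are $\mathfrak C$-opposite. Then $(x_p)$ is $\mathfrak C$-geodesic. -/

import Mathlib

open Set Filter Topology MeasureTheory

namespace EuclBuilding

/-! ### The model flat: a Euclidean vector space with a finite reflection group -/

section ModelFlat

variable {A : Type*} [NormedAddCommGroup A] [InnerProductSpace ℝ A]

/-- `r` is the orthogonal reflection in a linear hyperplane. -/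
def IsReflection (r : A ≃ₗᵢ[ℝ] A) : Prop :=
  ∃ v : A, v ≠ 0 ∧ r = (Submodule.span ℝ {v})ᗮ.reflection

/-- A finite reflection group: a finite group of linear isometries generated by the reflections it
contains, and (as usual for Weyl groups) fixing no nonzero vector, so that the closed Weyl chambers
are cones over simplices. -/
structure IsFiniteReflectionGroup (W : Subgroup (A ≃ₗᵢ[ℝ] A)) : Prop where
  finite : (W : Set (A ≃ₗᵢ[ℝ] A)).Finite
  generated : Subgroup.closure {r | r ∈ W ∧ IsReflection r} = W
  essential : ∀ a : A, (∀ w ∈ W, w a = a) → a = 0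

/-- A vector is singular if it lies on the fixed hyperplane of some reflection of `W`. -/
def IsSingular (W : Subgroup (A ≃ₗᵢ[ℝ] A)) (a : A) : Prop :=
  ∃ r ∈ W, IsReflection r ∧ r a = a

/-- The (open, vectorial) Weyl chambers: connected components of the set of regular vectors. -/
def IsWeylChamber (W : Subgroup (A ≃ₗᵢ[ℝ] A)) (C : Set A) : Prop :=
  ∃ c : A, ¬ IsSingular W c ∧ C = connectedComponentIn {a | ¬ IsSingular W a} c

/-- The group of affine isomorphisms of `A` with linear part in `W`, as a set of maps. -/
def affineWeyl (W : Subgroup (A ≃ₗᵢ[ℝ] A)) : Set (A → A) :=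
  {g | ∃ w ∈ W, ∃ τ : A, g = fun a => w a + τ}

/-- `η` is piecewise affine (in particular continuous) on the interval `[s, s']`. -/
def IsPiecewiseAffineOn (η : ℝ → A) (s s' : ℝ) : Prop :=
  ∃ (N : ℕ) (t : ℕ → ℝ), Monotone t ∧ t 0 = s ∧ t N = s' ∧
    ∀ i < N, ∃ u v : A, ∀ r ∈ Icc (t i) (t (i + 1)), η r = u + r • v

end ModelFlat

/-! ### Geodesic segments and CAT(0) spaces -/

section Metric

variable {E : Type*} [MetricSpace E]

/-- The segment `[x, y]`; in a CAT(0) space it is the unique geodesic segment from `x` to `y`. -/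
def segm (x y : E) : Set E := {z | dist x z + dist z y = dist x y}

/-- CAT(0) spaces: geodesic spaces in which the distance from a vertex `p` of a geodesic triangle
`p, x, y` to a point `m` of the opposite side is at most the corresponding distance in a Euclidean
triangle with the same side lengths. -/
structure IsCAT0 (E : Type*) [MetricSpace E] : Prop where
  geodesic : ∀ x y : E, ∃ γ : ℝ → E, γ 0 = x ∧ γ (dist x y) = y ∧
    ∀ s ∈ Icc 0 (dist x y), ∀ t ∈ Icc 0 (dist x y), dist (γ s) (γ t) = |s - t|
  comparison : ∀ (p x y m : E) (t : ℝ), 0 ≤ t → t ≤ 1 →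
    dist x m = t * dist x y → dist m y = (1 - t) * dist x y →
    dist p m ^ 2 ≤ (1 - t) * dist p x ^ 2 + t * dist p y ^ 2 - t * (1 - t) * dist x y ^ 2

/-- The germ of `S` at `x` is contained in the germ of `T` at `x`. -/
def GermLE (x : E) (S T : Set E) : Prop := ∀ᶠ z in 𝓝 x, z ∈ S → z ∈ T

/-- `S` and `T` have the same germ at `x`. -/
def GermEq (x : E) (S T : Set E) : Prop := ∀ᶠ z in 𝓝 x, z ∈ S ↔ z ∈ T

/-- `γ` is, on `[m, n]`, the piecewise affine path with successive vertices `x m, …, x n`: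
on `[p, p + 1]` it runs through the segment `[x p, x (p + 1)]` at constant speed. -/
def IsPathThrough (γ : ℝ → E) (x : ℤ → E) (m n : ℤ) : Prop :=
  γ m = x m ∧
  ∀ p : ℤ, m ≤ p → p < n → ∀ t ∈ Icc (0 : ℝ) 1,
    dist (x p) (γ (p + t)) = t * dist (x p) (x (p + 1)) ∧
    dist (γ (p + t)) (x (p + 1)) = (1 - t) * dist (x p) (x (p + 1))

end Metric

/-! ### Euclidean buildings -/

section Building

variable {A : Type*} [NormedAddCommGroup A] [InnerProductSpace ℝ A]
variable {E : Type*} [MetricSpace E]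

/-- `E`, with the collection `F` of marked flats, is a Euclidean building (not necessarily discrete,
locally compact or complete) with model flat `(A, W)`. -/
structure IsEuclideanBuilding (W : Subgroup (A ≃ₗᵢ[ℝ] A)) (F : Set (A → E)) : Prop where
  cat0 : IsCAT0 E
  nonempty : F.Nonempty
  isometry : ∀ f ∈ F, Isometry f
  /-- Invariance under precomposition by the affine Weyl group. -/
  precomp : ∀ f ∈ F, ∀ g ∈ affineWeyl W, f ∘ g ∈ F
  /-- The transition map `f'⁻¹ ∘ f` is the restriction of an element of the affine Weyl group. -/
  transition : ∀ f ∈ F, ∀ f' ∈ F, ∃ g ∈ affineWeyl W, ∀ a b : A, f a = f' b → b = g a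
  /-- The initial parts of any two nontrivial geodesics lie in a common marked flat. -/
  initial : ∀ x x' y y' : E, x ≠ x' → y ≠ y' → ∃ f ∈ F,
    GermLE x (segm x x') (range f) ∧ GermLE y (segm y y') (range f)

/-- The segment `[x, y]` is singular: in a marked flat it is `[a, b]` with `b - a` singular. -/
def SingularSegm (W : Subgroup (A ≃ₗᵢ[ℝ] A)) (F : Set (A → E)) (x y : E) : Prop :=
  ∃ f ∈ F, ∃ a b : A, f a = x ∧ f b = y ∧ IsSingular W (b - a)

/-- The closed Weyl chambers of `E` with vertex `x`; their germs at `x` are the closed chambers of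
the space of directions at `x`. -/
def IsClosedChamberAt (C : Set A) (F : Set (A → E)) (x : E) (S : Set E) : Prop :=
  ∃ f ∈ F, f 0 = x ∧ S = f '' closure C

/-- The germs at `x` of `S` and `T` are opposite chambers of the space of directions at `x`, i.e.
they lie in the germ of a common flat through `x` and are opposite there. (Other pairs of opposite
vectorial chambers in this flat are obtained by precomposing the marking with elements of `W`.) -/
def OppositeAt (C : Set A) (F : Set (A → E)) (x : E) (S T : Set E) : Prop :=
  ∃ f ∈ F, f 0 = x ∧ GermEq x S (f '' closure C) ∧ GermEq x T (f '' (-closure C))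

/-- The directions at `x` towards `y` and towards `z` are `C`-opposite: they are defined
(`y ≠ x` and `z ≠ x`) and contained in opposite closed chambers of the space of directions. -/
def COpposite (C : Set A) (F : Set (A → E)) (x y z : E) : Prop :=
  y ≠ x ∧ z ≠ x ∧ ∃ S T : Set E,
    IsClosedChamberAt C F x S ∧ IsClosedChamberAt C F x T ∧ OppositeAt C F x S T ∧
    GermLE x (segm x y) S ∧ GermLE x (segm x z) T

/-- The path `γ` on `[s, s']` is a `C`-geodesic: it is the image by a marked flat of a piecewise
affine path in `A` with derivative almost everywhere in the closed Weyl chamber. -/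
def IsCGeodesic (C : Set A) (F : Set (A → E)) (γ : ℝ → E) (s s' : ℝ) : Prop :=
  ∃ f ∈ F, ∃ η : ℝ → A, IsPiecewiseAffineOn η s s' ∧ (∀ t ∈ Icc s s', γ t = f (η t)) ∧
    ∀ᵐ t ∂(volume : Measure ℝ), t ∈ Ioo s s' → ∃ v ∈ closure C, HasDerivAt η v t

/-- The sequence `(x p)`, `p ∈ I`, is `C`-geodesic: each finite stretch `x m, …, x n` of it is the
sequence of vertices of a piecewise affine path that is a `C`-geodesic. For `I` finite and nonempty
this says that the whole path is a `C`-geodesic. -/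
def IsCGeodesicSeq (C : Set A) (F : Set (A → E)) (x : ℤ → E) (I : Set ℤ) : Prop :=
  ∀ m ∈ I, ∀ n ∈ I, m ≤ n → ∃ γ : ℝ → E, IsPathThrough γ x m n ∧ IsCGeodesic C F γ m n

end Building

end EuclBuilding

/-! The proof is by induction on the number of points, keeping `x m, …, x n` in one marked flat with
successive differences in the closed chamber `D` (`IsChainIn`). To add `x (n + 1)` it is enough that
the directions at `x n` of `x m` and `x (n + 1)` are opposite. These three points then lie in a
marked flat (`LocallyOpposite.exists_flat`), and two flats that agree at `x m` and `x n` agree on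
their Weyl hull, which contains the intermediate points (`IsEuclideanBuilding.agree_hull`).

Condition 1 gives opposition for `x (n - 1)` instead of `x m`. If the last edge is regular, its
direction lies in a unique chamber, which also contains the direction of `x m`, so opposition passes
to `x m` (`LocallyOpposite.of_regular`). If it is singular, condition 2 gives opposition for `x (n -
2)`, and the vector from `x (n - 2)` to `x n` is regular: in the plane, two vectors of `D` whose sum
lies on a wall are on one ray, which would put `x (n - 1)` on `[x (n - 2), x n]`.

The geometric input is that flats sharing a segment of regular direction share the germ of the
chamber. As `W` is finite, its orbits are discrete, so agreement of two flats passes to nearby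
directions (`IsEuclideanBuilding.agree_of_close`). Continuity arguments along `[0, 1]` then turn
germs into hulls and segments. -/

namespace EuclBuilding

/-! ### Chambers of a finite reflection group in the plane -/

section ModelFlat

variable {A : Type*} [NormedAddCommGroup A] [InnerProductSpace ℝ A]

/-- The orthogonal reflection in the hyperplane orthogonal to `v`. -/
noncomputable def hyperplaneReflection (v : A) : A ≃ₗᵢ[ℝ] A :=
  (Submodule.span ℝ {v})ᗮ.reflection

theorem hyperplaneReflection_apply (v a : A) :
    hyperplaneReflection v a = a - (2 * (inner ℝ v a / ‖v‖ ^ 2)) • v := by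
  rw [hyperplaneReflection, Submodule.reflection_orthogonal_apply,
    Submodule.reflection_singleton_apply]
  simp only [RCLike.ofReal_real_eq_id, id_eq, neg_sub, mul_smul, ofNat_smul_eq_nsmul]

theorem hyperplaneReflection_apply_eq_self_iff (v a : A) :
    hyperplaneReflection v a = a ↔ inner ℝ v a = 0 := by
  rw [hyperplaneReflection, Submodule.reflection_eq_self_iff,
    Submodule.mem_orthogonal_singleton_iff_inner_right]

theorem hyperplaneReflection_neg (v : A) : hyperplaneReflection (-v) = hyperplaneReflection v := by
  ext a
  rw [hyperplaneReflection_apply, hyperplaneReflection_apply, inner_neg_left, norm_neg]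
  module

theorem hyperplaneReflection_ne_one {v : A} (hv : v ≠ 0) : hyperplaneReflection v ≠ 1 := by
  intro h
  have h1 : inner ℝ v v = 0 := (hyperplaneReflection_apply_eq_self_iff v v).1 (by rw [h]; rfl)
  exact hv (inner_self_eq_zero.1 h1)

/-- A closed Weyl chamber `D` with interior `C`, for a finite group `W` of linear isometries. -/
structure IsChamberCone (W : Subgroup (A ≃ₗᵢ[ℝ] A)) (C D : Set A) : Prop where
  finite : (W : Set (A ≃ₗᵢ[ℝ] A)).Finite
  nonempty : C.Nonempty
  subset : C ⊆ D
  zero_mem : (0 : A) ∈ D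
  add_mem : ∀ {a b}, a ∈ D → b ∈ D → a + b ∈ D
  smul_mem : ∀ {a} {t : ℝ}, 0 ≤ t → a ∈ D → t • a ∈ D
  add_mem_left : ∀ {a b}, a ∈ C → b ∈ D → a + b ∈ C
  smul_mem_left : ∀ {a} {t : ℝ}, 0 < t → a ∈ C → t • a ∈ C
  exists_mem : ∀ a, ∃ w ∈ W, w a ∈ D
  unique : ∀ {a w}, a ∈ D → w ∈ W → w a ∈ D → w a = a
  stabilizer : ∀ {a w}, a ∈ C → w ∈ W → w a = a → w = 1
  pointed : ∀ {a}, a ∈ D → -a ∈ D → a = 0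
  exists_opposite : ∃ w ∈ W, ∀ a, a ∈ D ↔ -(w a) ∈ D
  singular : ∀ {a b}, a ∈ D → b ∈ D → IsSingular W (a + b) →
    ∃ t : ℝ, 0 ≤ t ∧ t ≤ 1 ∧ a = t • (a + b)
  regular : ∀ {a}, a ∈ D → ¬ IsSingular W a → a ∈ C

theorem exists_smul_eq_of_finrank_two (hA : Module.finrank ℝ A = 2) {v u a : A} (hv : v ≠ 0)
    (hu : u ≠ 0) (hvu : inner ℝ v u = 0) (hva : inner ℝ v a = 0) : ∃ t : ℝ, t • u = a := by
  have : Fact (Module.finrank ℝ A = 1 + 1) := ⟨hA⟩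
  have h1 : Module.finrank ℝ (Submodule.span ℝ {v})ᗮ = 1 :=
    Submodule.finrank_orthogonal_span_singleton hv
  have hu' : u ∈ (Submodule.span ℝ {v})ᗮ := Submodule.mem_orthogonal_singleton_iff_inner_right.2 hvu
  have ha' : a ∈ (Submodule.span ℝ {v})ᗮ := Submodule.mem_orthogonal_singleton_iff_inner_right.2 hva
  obtain ⟨t, ht⟩ := (finrank_eq_one_iff_of_nonzero' (⟨u, hu'⟩ : (Submodule.span ℝ {v})ᗮ)
    (by simpa using hu)).1 h1 ⟨a, ha'⟩
  exact ⟨t, by simpa using congrArg Subtype.val ht⟩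

theorem exists_orthogonal_ne_zero (hA : Module.finrank ℝ A = 2) {u : A} (hu : u ≠ 0) :
    ∃ v : A, v ≠ 0 ∧ inner ℝ u v = 0 := by
  have : Fact (Module.finrank ℝ A = 1 + 1) := ⟨hA⟩
  have h1 : Module.finrank ℝ (Submodule.span ℝ {u})ᗮ = 1 :=
    Submodule.finrank_orthogonal_span_singleton hu
  obtain ⟨⟨v, hv⟩, hv0, -⟩ := finrank_eq_one_iff'.1 h1
  exact ⟨v, by simpa using hv0, Submodule.mem_orthogonal_singleton_iff_inner_right.1 hv⟩

/-- In the plane, a nontrivial linear isometry fixing a nonzero vector is a reflection. -/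
theorem eq_hyperplaneReflection_of_apply_eq_self (hA : Module.finrank ℝ A = 2) {u : A} (hu : u ≠ 0)
    {w : A ≃ₗᵢ[ℝ] A} (hw : w ≠ 1) (hwu : w u = u) :
    ∃ v : A, v ≠ 0 ∧ w = hyperplaneReflection v ∧ inner ℝ v u = 0 := by
  obtain ⟨v, hv, huv⟩ := exists_orthogonal_ne_zero hA hu
  have hvu : inner ℝ v u = 0 := by rw [real_inner_comm]; exact huv
  have huw : inner ℝ u (w v) = 0 := by
    rw [← huv]; nth_rewrite 1 [← hwu]; exact w.inner_map_map u v
  obtain ⟨l, hl⟩ := exists_smul_eq_of_finrank_two hA hu hv huv huw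
  have hl1 : l = 1 ∨ l = -1 := by
    have h1 : ‖w v‖ = ‖v‖ := w.norm_map v
    rw [← hl, norm_smul, Real.norm_eq_abs] at h1
    have : ‖v‖ ≠ 0 := norm_ne_zero_iff.2 hv
    have h2 : |l| = 1 := by
      field_simp at h1
      exact h1
    exact eq_or_eq_neg_of_abs_eq h2
  have huu : inner ℝ u u ≠ 0 := fun h => hu (inner_self_eq_zero.1 h)
  have decomp : ∀ a : A, ∃ s t : ℝ, a = s • u + t • v := by
    intro a
    obtain ⟨t, ht⟩ := exists_smul_eq_of_finrank_two hA (a := a - (inner ℝ u a / inner ℝ u u) • u)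
      hu hv huv (by rw [inner_sub_right, inner_smul_right]; field_simp; simp)
    exact ⟨inner ℝ u a / inner ℝ u u, t, by rw [ht]; abel⟩
  refine ⟨v, hv, ?_, hvu⟩
  rcases hl1 with rfl | rfl
  · refine absurd ?_ hw
    ext a
    obtain ⟨s, t, rfl⟩ := decomp a
    rw [map_add, map_smul, map_smul, hwu, ← hl, one_smul]
    rfl
  · ext a
    obtain ⟨s, t, rfl⟩ := decomp a
    have h1 : hyperplaneReflection v u = u := (hyperplaneReflection_apply_eq_self_iff v u).2 hvu
    have h2 : hyperplaneReflection v v = (-1 : ℝ) • v := by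
      have : ‖v‖ ≠ 0 := norm_ne_zero_iff.2 hv
      rw [hyperplaneReflection_apply, real_inner_self_eq_norm_sq, div_self (by positivity)]
      module
    rw [map_add, map_smul, map_smul, hwu, ← hl, map_add, map_smul, map_smul, h1, h2]

variable {W : Subgroup (A ≃ₗᵢ[ℝ] A)}

theorem isSingular_iff (a : A) : IsSingular W a ↔
    ∃ v : A, v ≠ 0 ∧ hyperplaneReflection v ∈ W ∧ inner ℝ v a = 0 := by
  constructor
  · rintro ⟨r, hr, ⟨v, hv, rfl⟩, h⟩
    exact ⟨v, hv, hr, (hyperplaneReflection_apply_eq_self_iff v a).1 h⟩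
  · rintro ⟨v, hv, hr, h⟩
    exact ⟨_, hr, ⟨v, hv, rfl⟩, (hyperplaneReflection_apply_eq_self_iff v a).2 h⟩

theorem IsFiniteReflectionGroup.eq_zero_of_forall_inner (hW : IsFiniteReflectionGroup W) {a : A}
    (h : ∀ v : A, v ≠ 0 → hyperplaneReflection v ∈ W → inner ℝ v a = 0) : a = 0 := by
  apply hW.essential
  intro w hw
  rw [← hW.generated] at hw
  induction hw using Subgroup.closure_induction with
  | mem r hr =>
    obtain ⟨hr, v, hv, rfl⟩ := hr
    exact (hyperplaneReflection_apply_eq_self_iff v a).2 (h v hv hr)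
  | one => rfl
  | mul x y _ _ hx hy => exact (congrArg x hy).trans hx
  | inv x _ hx => exact (LinearIsometryEquiv.symm_apply_eq x).2 hx.symm

/-- In the plane a nontrivial isometry fixing a nonzero vector is already a reflection. The vector
`0` is singular because `W` contains some reflection: otherwise it would fix every vector. -/
theorem isSingular_iff_exists_fixing (hA : Module.finrank ℝ A = 2)
    (hW : IsFiniteReflectionGroup W) (a : A) :
    IsSingular W a ↔ ∃ w ∈ W, w ≠ 1 ∧ w a = a := by
  constructor
  · rintro ⟨r, hr, ⟨v, hv, rfl⟩, h⟩
    exact ⟨_, hr, hyperplaneReflection_ne_one hv, h⟩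
  · rintro ⟨w, hw, hw1, hwa⟩
    by_cases ha : a = 0
    · subst ha
      by_contra hs
      have : Nontrivial A := Module.nontrivial_of_finrank_pos (R := ℝ) (by omega)
      obtain ⟨x, hx⟩ := exists_ne (0 : A)
      refine hx (hW.eq_zero_of_forall_inner fun v hv hr => ?_)
      exact absurd ((isSingular_iff 0).2 ⟨v, hv, hr, inner_zero_right _⟩) hs
    · obtain ⟨v, hv, rfl, hva⟩ := eq_hyperplaneReflection_of_apply_eq_self hA ha hw1 hwa
      exact (isSingular_iff a).2 ⟨v, hv, hw, hva⟩

theorem isSingular_apply_iff (hA : Module.finrank ℝ A = 2) (hW : IsFiniteReflectionGroup W)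
    {w : A ≃ₗᵢ[ℝ] A} (hw : w ∈ W) (a : A) : IsSingular W (w a) ↔ IsSingular W a := by
  have key : ∀ w ∈ W, ∀ a, IsSingular W a → IsSingular W (w a) := by
    intro w hw a ha
    rw [isSingular_iff_exists_fixing hA hW] at ha ⊢
    obtain ⟨g, hg, hg1, hga⟩ := ha
    refine ⟨w * g * w⁻¹, W.mul_mem (W.mul_mem hw hg) (W.inv_mem hw), ?_, ?_⟩
    · intro h
      apply hg1
      have := mul_inv_eq_one.1 h
      simpa using this
    · change w (g (w.symm (w a))) = w a
      rw [w.symm_apply_apply, hga]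
  refine ⟨fun h => ?_, key w hw a⟩
  have := key w⁻¹ (W.inv_mem hw) _ h
  change IsSingular W (w.symm (w a)) at this
  rwa [w.symm_apply_apply] at this

theorem inner_pos_of_mem_component {c v a : A} (hv : v ≠ 0)
    (hr : hyperplaneReflection v ∈ W) (hvc : 0 < inner ℝ v c)
    (ha : a ∈ connectedComponentIn {a | ¬ IsSingular W a} c) : 0 < inner ℝ v a := by
  by_contra! h
  have hc : c ∈ {a | ¬ IsSingular W a} := by
    by_contra hc
    rw [connectedComponentIn_eq_empty hc] at ha
    exact ha
  obtain ⟨b, hb, hb0⟩ := isPreconnected_connectedComponentIn.intermediate_value ha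
    (mem_connectedComponentIn hc) (f := fun a => inner ℝ v a) (by fun_prop) ⟨h, hvc.le⟩
  exact (connectedComponentIn_subset _ _ hb) ((isSingular_iff b).2 ⟨v, hv, hr, hb0⟩)

/-- The intersection of the open half-spaces is convex, hence connected, and it avoids every wall
since `v` or `-v` is positive on `c`. Conversely, a connected set of regular vectors cannot cross a
wall. -/
theorem mem_component_iff {c : A} (hc : ¬ IsSingular W c) (a : A) :
    a ∈ connectedComponentIn {a | ¬ IsSingular W a} c ↔
      ∀ v : A, v ≠ 0 → hyperplaneReflection v ∈ W → 0 < inner ℝ v c → 0 < inner ℝ v a := by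
  refine ⟨fun ha v hv hr hvc => inner_pos_of_mem_component hv hr hvc ha, fun ha => ?_⟩
  set S : Set A := {a | ∀ v : A, v ≠ 0 → hyperplaneReflection v ∈ W → 0 < inner ℝ v c →
    0 < inner ℝ v a} with hS
  have hconv : Convex ℝ S := by
    intro x hx y hy s t hs ht hst v hv hr hvc
    rw [inner_add_right, inner_smul_right, inner_smul_right]
    have h1 := hx v hv hr hvc
    have h2 := hy v hv hr hvc
    rcases hs.lt_or_eq with hs | rfl
    · positivity
    · have : t = 1 := by linarith
      subst this
      simpa using h2
  refine hconv.isPreconnected.subset_connectedComponentIn (fun v hv hr hvc => hvc) ?_ ha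
  intro b hb hbs
  obtain ⟨v, hv, hr, hvb⟩ := (isSingular_iff b).1 hbs
  rcases lt_trichotomy (inner ℝ v c) 0 with h | h | h
  · have := hb (-v) (neg_ne_zero.2 hv) (by rwa [hyperplaneReflection_neg])
      (by rw [inner_neg_left]; linarith)
    rw [inner_neg_left] at this
    linarith
  · exact hc ((isSingular_iff c).2 ⟨v, hv, hr, h⟩)
  · exact (hb v hv hr h).ne' hvb

theorem mem_closure_component_iff {c : A} (hc : ¬ IsSingular W c) (a : A) :
    a ∈ closure (connectedComponentIn {a | ¬ IsSingular W a} c) ↔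
      ∀ v : A, v ≠ 0 → hyperplaneReflection v ∈ W → 0 < inner ℝ v c → 0 ≤ inner ℝ v a := by
  constructor
  · intro ha v hv hr hvc
    have hcl : IsClosed {a : A | 0 ≤ inner ℝ v a} :=
      isClosed_le continuous_const (by fun_prop)
    exact closure_minimal (fun b hb => (inner_pos_of_mem_component hv hr hvc hb).le) hcl ha
  · intro ha
    have ht : Tendsto (fun e : ℝ => a + e • c) (𝓝[>] 0) (𝓝 a) := by
      have : Continuous fun e : ℝ => a + e • c := by fun_prop
      have := this.tendsto 0
      simp only [zero_smul, add_zero] at this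
      exact this.mono_left nhdsWithin_le_nhds
    refine mem_closure_of_tendsto ht ?_
    filter_upwards [self_mem_nhdsWithin] with e he
    rw [mem_component_iff hc]
    intro v hv hr hvc
    rw [inner_add_right, inner_smul_right]
    have := ha v hv hr hvc
    have := mul_pos (mem_Ioi.1 he) hvc
    linarith

/-- An element of the orbit of `a` with the largest inner product with a regular vector `c` lies in
the closed chamber of `c`. -/
theorem exists_mem_closure_forall_inner_le (hW : IsFiniteReflectionGroup W) {c : A}
    (hc : ¬ IsSingular W c) (a : A) : ∃ w ∈ W,
      w a ∈ closure (connectedComponentIn {a | ¬ IsSingular W a} c) ∧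
      ∀ w' ∈ W, inner ℝ (w' a) c ≤ (inner ℝ (w a) c : ℝ) := by
  obtain ⟨w, hw, hmax⟩ := Set.exists_max_image (W : Set (A ≃ₗᵢ[ℝ] A))
    (fun w => (inner ℝ (w a) c : ℝ)) hW.finite ⟨1, W.one_mem⟩
  refine ⟨w, hw, (mem_closure_component_iff hc _).2 fun v hv hr hvc => ?_, hmax⟩
  -- Reflecting `w a` in `v` changes its product with `c` by a negative multiple of `⟪v, w a⟫ ⟪v,
  -- c⟫`, so maximality forces `⟪v, w a⟫ ≥ 0`.
  have h := hmax (hyperplaneReflection v * w) (W.mul_mem hr hw)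
  change inner ℝ (hyperplaneReflection v (w a)) c ≤ (inner ℝ (w a) c : ℝ) at h
  rw [hyperplaneReflection_apply, inner_sub_left, inner_smul_left] at h
  simp only [conj_trivial] at h
  have h0 : 0 ≤ 2 * (inner ℝ v (w a) / ‖v‖ ^ 2) * inner ℝ v c := by linarith
  have hn : 0 < ‖v‖ ^ 2 := by
    have := norm_pos_iff.2 hv
    positivity
  by_contra! hneg
  have : inner ℝ v (w a) / ‖v‖ ^ 2 < 0 := div_neg_of_neg_of_pos hneg hn
  nlinarith

variable {C : Set A}

theorem IsWeylChamber.isChamberCone (hA : Module.finrank ℝ A = 2)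
    (hW : IsFiniteReflectionGroup W) (hC : IsWeylChamber W C) : IsChamberCone W C (closure C) := by
  have : Nontrivial A := Module.nontrivial_of_finrank_pos (R := ℝ) (by omega)
  obtain ⟨c, hc, hCc⟩ := hC
  have memC : ∀ a, a ∈ C ↔ _ := fun a => hCc ▸ mem_component_iff hc a
  have memD : ∀ a, a ∈ closure C ↔ _ := fun a => hCc ▸ mem_closure_component_iff hc a
  have hCsub : ∀ a ∈ C, ¬ IsSingular W a := fun a ha =>
    connectedComponentIn_subset _ _ (hCc ▸ ha)
  have hcC : c ∈ C := hCc ▸ mem_connectedComponentIn hc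
  have hCeq : ∀ a ∈ C, connectedComponentIn {a | ¬ IsSingular W a} a = C := fun a ha => by
    rw [hCc] at ha ⊢
    exact (connectedComponentIn_eq ha).symm
  have hpre : IsPreconnected C := hCc ▸ isPreconnected_connectedComponentIn
  have regular : ∀ {a}, a ∈ closure C → ¬ IsSingular W a → a ∈ C := by
    intro a ha hs
    refine (memC a).2 fun v hv hr hvc => lt_of_le_of_ne ((memD a).1 ha v hv hr hvc) fun h => ?_
    exact hs ((isSingular_iff a).2 ⟨v, hv, hr, h.symm⟩)
  have add_mem : ∀ {a b}, a ∈ closure C → b ∈ closure C → a + b ∈ closure C := by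
    intro a b ha hb
    refine (memD _).2 fun v hv hr hvc => ?_
    rw [inner_add_right]
    exact add_nonneg ((memD a).1 ha v hv hr hvc) ((memD b).1 hb v hv hr hvc)
  have add_mem_left : ∀ {a b}, a ∈ C → b ∈ closure C → a + b ∈ C := by
    intro a b ha hb
    refine (memC _).2 fun v hv hr hvc => ?_
    rw [inner_add_right]
    exact add_pos_of_pos_of_nonneg ((memC a).1 ha v hv hr hvc) ((memD b).1 hb v hv hr hvc)
  have smul_mem : ∀ {a} {t : ℝ}, 0 ≤ t → a ∈ closure C → t • a ∈ closure C := by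
    intro a t ht ha
    refine (memD _).2 fun v hv hr hvc => ?_
    rw [inner_smul_right]
    exact mul_nonneg ht ((memD a).1 ha v hv hr hvc)
  have smul_mem_left : ∀ {a} {t : ℝ}, 0 < t → a ∈ C → t • a ∈ C := by
    intro a t ht ha
    refine (memC _).2 fun v hv hr hvc => ?_
    rw [inner_smul_right]
    exact mul_pos ht ((memC a).1 ha v hv hr hvc)
  have stab : ∀ {a w}, a ∈ C → w ∈ W → w a = a → w = 1 := by
    intro a w ha hw hwa
    by_contra h1
    exact hCsub a ha ((isSingular_iff_exists_fixing hA hW a).2 ⟨w, hw, h1, hwa⟩)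
  have maps : ∀ {u w}, u ∈ C → w ∈ W → w u ∈ C → ∀ b ∈ C, w b ∈ C := by
    intro u w hu hw hwu b hb
    have : w '' C ⊆ connectedComponentIn {a | ¬ IsSingular W a} (w u) := by
      refine (hpre.image w w.continuous.continuousOn).subset_connectedComponentIn
        (mem_image_of_mem _ hu) ?_
      rintro _ ⟨x, hx, rfl⟩
      exact fun h => hCsub x hx ((isSingular_apply_iff hA hW hw x).1 h)
    rw [hCeq _ hwu] at this
    exact this (mem_image_of_mem _ hb)
  -- The sum of `(w ^ i) c` over one period of `w` is fixed by `w` and lies in the cone `C`, where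
  -- stabilizers are trivial.
  have fix : ∀ {w}, w ∈ W → (∀ b ∈ C, w b ∈ C) → w = 1 := by
    intro w hw hm
    have hfin : IsOfFinOrder w := by
      have : Finite W := hW.finite
      exact Submonoid.isOfFinOrder_coe.2 (isOfFinOrder_of_finite (⟨w, hw⟩ : W))
    set n := orderOf w with hn
    have hnpos : 0 < n := hfin.orderOf_pos
    have hpow : ∀ k : ℕ, (w ^ k) c ∈ C := by
      intro k
      induction k with
      | zero => exact hcC
      | succ k ih => rw [pow_succ']; exact hm _ ih
    have hsum : ∀ k : ℕ, ∑ i ∈ Finset.range (k + 1), (w ^ i) c ∈ C := by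
      intro k
      induction k with
      | zero => simpa using hcC
      | succ k ih => rw [Finset.sum_range_succ]; exact add_mem_left ih (subset_closure (hpow _))
    obtain ⟨k, hk⟩ := Nat.exists_eq_succ_of_ne_zero hnpos.ne'
    refine stab (hsum k) hw ?_
    rw [map_sum, Finset.sum_range_succ, Finset.sum_range_succ']
    have h2 : ∀ i, w ((w ^ i) c) = (w ^ (i + 1)) c := fun i => by rw [pow_succ']; rfl
    simp only [h2]
    congr 1
    rw [show k + 1 = n from hk.symm, hn, pow_orderOf_eq_one]
    rfl
  -- The maximizing element of `W` maps `u` into `C`, so it preserves `C` and is `1`.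
  have inner_le : ∀ {u c' w}, u ∈ C → c' ∈ C → w ∈ W → inner ℝ (w u) c' ≤ (inner ℝ u c' : ℝ) := by
    intro u c' w hu hc' hw
    obtain ⟨w', hw', hD, hmax⟩ := exists_mem_closure_forall_inner_le hW (hCsub c' hc') u
    rw [hCeq c' hc'] at hD
    have h1 : w' u ∈ C := regular hD fun h => hCsub u hu ((isSingular_apply_iff hA hW hw' u).1 h)
    have h2 := fix hw' (maps hu hw' h1)
    subst h2
    exact hmax w hw
  have inner_le' : ∀ {u c' w}, u ∈ closure C → c' ∈ closure C → w ∈ W →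
      inner ℝ (w u) c' ≤ (inner ℝ u c' : ℝ) := by
    intro u c' w hu hc' hw
    have hcl1 : IsClosed {c' : A | inner ℝ (w u) c' ≤ (inner ℝ u c' : ℝ)} :=
      isClosed_le (by fun_prop) (by fun_prop)
    refine closure_minimal (fun b hb => ?_) hcl1 hc'
    have hcl2 : IsClosed {u : A | inner ℝ (w u) b ≤ (inner ℝ u b : ℝ)} :=
      isClosed_le (by fun_prop) (by fun_prop)
    exact closure_minimal (fun x hx => inner_le hx hb hw) hcl2 hu
  have pointed : ∀ {a}, a ∈ closure C → -a ∈ closure C → a = 0 := by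
    intro a h1 h2
    refine hW.eq_zero_of_forall_inner fun v hv hr => ?_
    have key : ∀ v : A, v ≠ 0 → hyperplaneReflection v ∈ W → 0 < inner ℝ v c → inner ℝ v a = 0 := by
      intro v hv hr hvc
      have h3 := (memD _).1 h1 v hv hr hvc
      have h4 := (memD _).1 h2 v hv hr hvc
      rw [inner_neg_right] at h4
      linarith
    rcases lt_trichotomy (inner ℝ v c) 0 with h | h | h
    · have := key (-v) (neg_ne_zero.2 hv) (by rwa [hyperplaneReflection_neg])
        (by rw [inner_neg_left]; linarith)
      rw [inner_neg_left] at this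
      linarith
    · exact absurd ((isSingular_iff c).2 ⟨v, hv, hr, h⟩) hc
    · exact key v hv hr h
  have exists_mem : ∀ a, ∃ w ∈ W, w a ∈ closure C := by
    intro a
    obtain ⟨w, hw, h, -⟩ := exists_mem_closure_forall_inner_le hW hc a
    exact ⟨w, hw, hCc ▸ h⟩
  refine ⟨hW.finite, ⟨c, hcC⟩, subset_closure, ?_, add_mem, smul_mem, add_mem_left,
    smul_mem_left, exists_mem, ?_, stab, pointed, ?_, ?_, regular⟩
  · exact (memD 0).2 fun v _ _ _ => by simp
  · intro a w ha hw hwa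
    -- Maximality for `w` and for its inverse gives `⟪a, w a⟫ = ‖w a‖² = ‖a‖²`, whence `w a = a`.
    have h1 : inner ℝ a (w a) ≤ (inner ℝ (w a) (w a) : ℝ) := by
      have := inner_le' hwa hwa (W.inv_mem hw)
      change inner ℝ (w.symm (w a)) (w a) ≤ _ at this
      rwa [w.symm_apply_apply] at this
    have h2 : inner ℝ (w a) (w a) ≤ (inner ℝ a (w a) : ℝ) := inner_le' ha hwa hw
    have h3 : (inner ℝ (w a) (w a) : ℝ) = inner ℝ a a := w.inner_map_map a a
    have h4 : inner ℝ (w a - a) (w a - a) = (0 : ℝ) := by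
      rw [inner_sub_left, inner_sub_right, inner_sub_right, real_inner_comm a (w a)]
      linarith
    exact sub_eq_zero.1 (inner_self_eq_zero.1 h4)
  -- The element bringing `-c` into the closed chamber maps `-C` into `C`. Its square preserves `C`,
  -- hence is `1`, which gives the converse inclusion.
  · obtain ⟨w, hw, hwD⟩ := exists_mem (-c)
    have hsingneg : ∀ a, IsSingular W (-a) → IsSingular W a := by
      intro a h
      rw [isSingular_iff] at h ⊢
      obtain ⟨v, hv, hr, h⟩ := h
      exact ⟨v, hv, hr, by simpa using h⟩
    have hwC : w (-c) ∈ C := regular hwD fun h =>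
      hc (hsingneg c ((isSingular_apply_iff hA hW hw _).1 h))
    have hmaps : ∀ b ∈ C, w (-b) ∈ C := by
      intro b hb
      have : (fun x => w (-x)) '' C ⊆ connectedComponentIn {a | ¬ IsSingular W a} (w (-c)) := by
        refine (hpre.image _ (by fun_prop)).subset_connectedComponentIn
          (mem_image_of_mem _ hcC) ?_
        rintro _ ⟨x, hx, rfl⟩
        exact fun h => hCsub x hx (hsingneg x ((isSingular_apply_iff hA hW hw _).1 h))
      rw [hCeq _ hwC] at this
      exact this (mem_image_of_mem _ hb)
    have hmapsD : ∀ b ∈ closure C, -(w b) ∈ closure C := by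
      intro b hb
      refine map_mem_closure (f := fun b => -(w b)) (by fun_prop) hb fun x hx => ?_
      have := hmaps x hx
      rwa [map_neg] at this
    have hw2 : w * w = 1 := by
      refine fix (W.mul_mem hw hw) fun b hb => ?_
      have := hmaps _ (hmaps b hb)
      rw [map_neg, map_neg, map_neg, neg_neg] at this
      exact this
    refine ⟨w, hw, fun a => ⟨hmapsD a, fun h => ?_⟩⟩
    have h1 := hmapsD _ h
    rw [map_neg, neg_neg] at h1
    change (w * w) a ∈ _ at h1
    rwa [hw2] at h1
  · intro a b ha hb hs
    by_cases h0 : a + b = 0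
    · refine ⟨0, le_rfl, zero_le_one, ?_⟩
      rw [zero_smul]
      refine pointed ha ?_
      rwa [← eq_neg_of_add_eq_zero_right h0]
    have main : ∃ v : A, v ≠ 0 ∧ hyperplaneReflection v ∈ W ∧ inner ℝ v (a + b) = 0 ∧
        0 < inner ℝ v c := by
      obtain ⟨v, hv, hr, hvab⟩ := (isSingular_iff _).1 hs
      rcases lt_trichotomy (inner ℝ v c) 0 with h | h | h
      · exact ⟨-v, neg_ne_zero.2 hv, by rwa [hyperplaneReflection_neg], by simpa using hvab,
          by rw [inner_neg_left]; linarith⟩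
      · exact absurd ((isSingular_iff c).2 ⟨v, hv, hr, h⟩) hc
      · exact ⟨v, hv, hr, hvab, h⟩
    -- The product with `v` is nonnegative on `a` and `b` and zero on their sum, so both lie on the
    -- wall, which in the plane is the line of `a + b`. Pointedness of the cone makes `t` and `1 -
    -- t` nonnegative.
    obtain ⟨v, hv, hr, hvab, hvc⟩ := main
    have h1 := (memD a).1 ha v hv hr hvc
    have h2 := (memD b).1 hb v hv hr hvc
    have h3 : inner ℝ v a + inner ℝ v b = 0 := by rw [← inner_add_right]; exact hvab
    have nonneg : ∀ (x : A) (t : ℝ), x ∈ closure C → t • (a + b) = x → 0 ≤ t := by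
      intro x t hx ht
      by_contra! hneg
      refine h0 (pointed (add_mem ha hb) ?_)
      have : -(a + b) = (-t⁻¹) • x := by
        rw [← ht, smul_smul, neg_mul, inv_mul_cancel₀ hneg.ne, neg_one_smul]
      rw [this]
      exact smul_mem (by rw [neg_nonneg]; exact (inv_lt_zero.2 hneg).le) hx
    obtain ⟨t, ht⟩ := exists_smul_eq_of_finrank_two hA hv h0 hvab
      (show inner ℝ v a = 0 by linarith)
    refine ⟨t, nonneg a t ha ht, ?_, ht.symm⟩
    have := nonneg b (1 - t) hb (by rw [sub_smul, ht, one_smul]; abel)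
    linarith

end ModelFlat

/-- Induction along the real interval `[0, 1]`. -/
theorem unitInterval_induction (P : ℝ → Prop) (h0 : P 0)
    (hl : ∀ t, 0 < t → t ≤ 1 → (∀ δ > 0, ∃ s, P s ∧ 0 ≤ s ∧ t - δ < s ∧ s < t) → P t)
    (hr : ∀ t, 0 ≤ t → t < 1 → P t → ∃ s, t < s ∧ s ≤ 1 ∧ P s) : P 1 := by
  set T : Set ℝ := {t | 0 ≤ t ∧ t ≤ 1 ∧ P t} with hT
  have hbdd : BddAbove T := ⟨1, fun t ht => ht.2.1⟩
  have h0T : (0 : ℝ) ∈ T := ⟨le_rfl, zero_le_one, h0⟩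
  have hnonneg : 0 ≤ sSup T := le_csSup hbdd h0T
  have hle : sSup T ≤ 1 := csSup_le ⟨0, h0T⟩ fun t ht => ht.2.1
  have hmem : P (sSup T) := by
    by_contra hP
    have hpos : 0 < sSup T := lt_of_le_of_ne hnonneg fun h => hP (h ▸ h0)
    refine hP (hl _ hpos hle fun δ hδ => ?_)
    obtain ⟨s, hs, hlt⟩ := exists_lt_of_lt_csSup ⟨0, h0T⟩ (show sSup T - δ < sSup T by linarith)
    exact ⟨s, hs.2.2, hs.1, hlt, lt_of_le_of_ne (le_csSup hbdd hs) fun h => hP (h ▸ hs.2.2)⟩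
  rcases hle.lt_or_eq with hlt | heq
  · obtain ⟨s, h1, h2, h3⟩ := hr _ hnonneg hlt hmem
    exact absurd (le_csSup hbdd ⟨hnonneg.trans h1.le, h2, h3⟩) (not_le.2 h1)
  · exact heq ▸ hmem

/-! ### Uniqueness of geodesics and metric segments -/

section Metric

variable {E : Type*} [MetricSpace E]

/-- With `m'` as the vertex of the triangle, the right side of the comparison inequality vanishes.
-/
theorem IsCAT0.eq_of_dist_eq (hE : IsCAT0 E) {x y m m' : E} {t : ℝ} (h0 : 0 ≤ t) (h1 : t ≤ 1)
    (hx : dist x m = t * dist x y) (hy : dist m y = (1 - t) * dist x y)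
    (hx' : dist x m' = t * dist x y) (hy' : dist m' y = (1 - t) * dist x y) : m = m' := by
  have h := hE.comparison m' x y m t h0 h1 hx hy
  rw [dist_comm m' x, hx', hy'] at h
  have h2 : dist m' m ^ 2 ≤ 0 := by nlinarith
  have h3 : dist m' m = 0 := by
    have := dist_nonneg (x := m') (y := m)
    nlinarith
  exact (dist_eq_zero.1 h3).symm

theorem left_mem_segm (x y : E) : x ∈ segm x y := by simp [segm]

theorem mem_segm_trans {x y z w : E} (h1 : w ∈ segm x z) (h2 : z ∈ segm x y) : w ∈ segm x y := by
  have h1' : dist x w + dist w z = dist x z := h1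
  have h2' : dist x z + dist z y = dist x y := h2
  change dist x w + dist w y = dist x y
  have := dist_triangle w z y
  have := dist_triangle x w y
  linarith

theorem mem_segm_of_mem_of_mem {x y z w : E} (h1 : w ∈ segm x z) (h2 : z ∈ segm x y) :
    z ∈ segm w y := by
  have h1' : dist x w + dist w z = dist x z := h1
  have h2' : dist x z + dist z y = dist x y := h2
  change dist w z + dist z y = dist w y
  have := dist_triangle w z y
  have := dist_triangle x w y
  linarith

theorem mem_segm_comm {x y z : E} : z ∈ segm x y ↔ z ∈ segm y x := by
  change dist x z + dist z y = dist x y ↔ dist y z + dist z x = dist y x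
  rw [dist_comm x z, dist_comm x y, dist_comm y z, add_comm]

end Metric

/-! ### Marked flats and their transition maps -/

section Building

variable {A : Type*} [NormedAddCommGroup A] [InnerProductSpace ℝ A]
variable {E : Type*} [MetricSpace E] {W : Subgroup (A ≃ₗᵢ[ℝ] A)} {F : Set (A → E)}

theorem affineWeyl_apply_mem {w : A ≃ₗᵢ[ℝ] A} (hw : w ∈ W) (τ : A) :
    (fun a => w a + τ) ∈ affineWeyl W := ⟨w, hw, τ, rfl⟩

section flats

variable {f f' : A → E} (hE : IsEuclideanBuilding W F) (hf : f ∈ F) (hf' : f' ∈ F)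

include hE hf

theorem IsEuclideanBuilding.dist_eq (a b : A) : dist (f a) (f b) = ‖b - a‖ := by
  rw [(hE.isometry f hf).dist_eq, dist_eq_norm, norm_sub_rev]

theorem IsEuclideanBuilding.dist_lineMap (a b : A) {t : ℝ} (h0 : 0 ≤ t) (h1 : t ≤ 1) :
    dist (f a) (f (a + t • (b - a))) = t * dist (f a) (f b) ∧
    dist (f (a + t • (b - a))) (f b) = (1 - t) * dist (f a) (f b) := by
  rw [hE.dist_eq hf, hE.dist_eq hf, hE.dist_eq hf]
  constructor
  · rw [add_sub_cancel_left, norm_smul, Real.norm_of_nonneg h0]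
  · rw [show b - (a + t • (b - a)) = (1 - t) • (b - a) by module, norm_smul,
      Real.norm_of_nonneg (by linarith)]

theorem IsEuclideanBuilding.lineMap_mem_segm (a b : A) {t : ℝ} (h0 : 0 ≤ t) (h1 : t ≤ 1) :
    f (a + t • (b - a)) ∈ segm (f a) (f b) := by
  obtain ⟨h2, h3⟩ := hE.dist_lineMap hf a b h0 h1
  change _ + _ = _
  rw [h2, h3]
  ring

theorem IsEuclideanBuilding.exists_of_mem_segm {a b : A} {z : E} (hz : z ∈ segm (f a) (f b)) :
    ∃ t : ℝ, 0 ≤ t ∧ t ≤ 1 ∧ z = f (a + t • (b - a)) := by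
  have hz' : dist (f a) z + dist z (f b) = dist (f a) (f b) := hz
  rcases (dist_nonneg (x := f a) (y := f b)).eq_or_lt with h | h
  · refine ⟨0, le_rfl, zero_le_one, ?_⟩
    rw [zero_smul, add_zero]
    have := dist_nonneg (x := f a) (y := z)
    have := dist_nonneg (x := z) (y := f b)
    exact (dist_eq_zero.1 (show dist (f a) z = 0 by linarith)).symm
  · set t := dist (f a) z / dist (f a) (f b) with ht
    have htm : t * dist (f a) (f b) = dist (f a) z := div_mul_cancel₀ _ h.ne'
    have h0 : 0 ≤ t := by positivity
    have h1 : t ≤ 1 := by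
      rw [ht, div_le_one h]
      have := dist_nonneg (x := z) (y := f b)
      linarith
    obtain ⟨h2, h3⟩ := hE.dist_lineMap hf a b h0 h1
    exact ⟨t, h0, h1, hE.cat0.eq_of_dist_eq h0 h1 htm.symm (by linarith) h2 h3⟩

/-- A marked flat that contains the germ of a segment `[f a, f b]` contains its initial part. -/
theorem IsEuclideanBuilding.exists_initial {a b : A} {S : Set E}
    (h : GermLE (f a) (segm (f a) (f b)) S) :
    ∃ δ : ℝ, 0 < δ ∧ δ ≤ 1 ∧ ∀ s, 0 ≤ s → s ≤ δ → f (a + s • (b - a)) ∈ S := by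
  have hcont : Continuous fun s : ℝ => f (a + s • (b - a)) :=
    (hE.isometry f hf).continuous.comp (by fun_prop)
  have ht : Tendsto (fun s : ℝ => f (a + s • (b - a))) (𝓝 0) (𝓝 (f a)) := by
    have := hcont.tendsto 0
    simpa using this
  obtain ⟨ε, hε, hb⟩ := Metric.eventually_nhds_iff.1 (ht.eventually h)
  refine ⟨min (ε / 2) 1, by positivity, min_le_right _ _, fun s hs0 hs => ?_⟩
  have h1 : s ≤ ε / 2 := hs.trans (min_le_left _ _)
  have h2 : s ≤ 1 := hs.trans (min_le_right _ _)
  exact hb (by rw [Real.dist_eq, sub_zero, abs_of_nonneg hs0]; linarith)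
    (hE.lineMap_mem_segm hf a b hs0 h2)

include hf'

/-- A marked flat can be reparametrized so that it agrees with a given one on the intersection. -/
theorem IsEuclideanBuilding.exists_normalized :
    ∃ g ∈ F, range g = range f' ∧ ∀ a b, f a = g b → a = b := by
  obtain ⟨g, hg, h⟩ := hE.transition f hf f' hf'
  obtain ⟨w, hw, τ, rfl⟩ := id hg
  refine ⟨f' ∘ _, hE.precomp f' hf' _ hg, ?_, fun a b hab => ?_⟩
  · refine Function.Surjective.range_comp (fun b => ⟨w.symm (b - τ), ?_⟩) f'
    simp
  · have := h _ _ hab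
    simpa using this.symm

/-- Vectors between the same points in two marked flats are conjugate under `W`. -/
theorem IsEuclideanBuilding.exists_linear :
    ∃ w ∈ W, ∀ a b a' b', f a = f' a' → f b = f' b' → b' - a' = w (b - a) := by
  obtain ⟨g, ⟨w, hw, τ, rfl⟩, h⟩ := hE.transition f hf f' hf'
  refine ⟨w, hw, fun a b a' b' h1 h2 => ?_⟩
  rw [h _ _ h1, h _ _ h2, map_sub]
  exact add_sub_add_right_eq_sub _ _ _

theorem IsEuclideanBuilding.eq_on_segment {a b : A} (ha : f a = f' a) (hb : f b = f' b) {t : ℝ}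
    (h0 : 0 ≤ t) (h1 : t ≤ 1) : f (a + t • (b - a)) = f' (a + t • (b - a)) := by
  obtain ⟨h2, h3⟩ := hE.dist_lineMap hf a b h0 h1
  obtain ⟨h4, h5⟩ := hE.dist_lineMap hf' a b h0 h1
  rw [← ha, ← hb] at h4 h5
  exact hE.cat0.eq_of_dist_eq h0 h1 h2 h3 h4 h5

end flats

/-- Elements of the `W`-orbit of a vector that are close enough to it are equal to it. -/
theorem exists_orbit_separation (hfin : (W : Set (A ≃ₗᵢ[ℝ] A)).Finite) (u : A) :
    ∃ η > 0, ∀ w ∈ W, ‖w u - u‖ < η → w u = u := by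
  have : ∀ᶠ η : ℝ in 𝓝[>] 0, ∀ w ∈ (W : Set (A ≃ₗᵢ[ℝ] A)), ‖w u - u‖ < η → w u = u := by
    rw [Filter.eventually_all_finite hfin]
    intro w hw
    by_cases h : w u = u
    · exact Eventually.of_forall fun _ _ => h
    · have hpos : 0 < ‖w u - u‖ := norm_pos_iff.2 (sub_ne_zero.2 h)
      filter_upwards [Ioo_mem_nhdsGT hpos] with η hη hlt
      exact absurd hlt (not_lt.2 hη.2.le)
  obtain ⟨η, h1, h2⟩ := (this.and self_mem_nhdsWithin).exists
  exact ⟨η, h2, h1⟩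

/-- For a vector `u` with trivial stabilizer, orbits of nearby vectors are uniformly separated. -/
theorem exists_uniform_orbit_separation (hfin : (W : Set (A ≃ₗᵢ[ℝ] A)).Finite) {u : A}
    (hu : ∀ w ∈ W, w u = u → w = 1) :
    ∃ η > 0, ∀ u', ‖u' - u‖ < η → ∀ w ∈ W, ‖w u' - u'‖ < η → w u' = u' := by
  obtain ⟨η, hη, h⟩ := exists_orbit_separation hfin u
  -- Three errors add up: `u` to `u'`, the displacement of `u'` by `w`, and the image under `w` of
  -- the first.
  refine ⟨η / 3, by positivity, fun u' hu' w hw hlt => ?_⟩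
  have h1 : ‖w u - u‖ < η := by
    have h2 : w u - u = w (u - u') + (w u' - u') + (u' - u) := by rw [map_sub]; abel
    calc ‖w u - u‖ ≤ ‖w (u - u')‖ + ‖w u' - u'‖ + ‖u' - u‖ := by
          rw [h2]; exact norm_add₃_le
      _ < η := by rw [w.norm_map, norm_sub_rev]; linarith
  rw [hu w hw (h w hw h1)]
  rfl

/-! ### Agreement of two flats on chamber germs and Weyl hulls -/

section flats

variable {f f' : A → E} (hE : IsEuclideanBuilding W F) (hf : f ∈ F) (hf' : f' ∈ F)

include hE hf hf'

/-- If two marked flats share the germ of a segment of direction `u₀`, then they share the germs of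
the segments in directions `u` close to `u₀`, relative to the separation of the orbit of `u`. -/
theorem IsEuclideanBuilding.agree_of_close {q u₀ u : A} {δ η : ℝ} (hδ : 0 < δ) (hu0 : u ≠ 0)
    (hq : f q = f' q) (h₀ : f (q + δ • u₀) = f' (q + δ • u₀))
    (hη : ∀ w ∈ W, ‖w u - u‖ < η → w u = u) (hclose : 2 * ‖u₀ - u‖ < η) :
    ∃ δ' : ℝ, 0 < δ' ∧ f (q + δ' • u) = f' (q + δ' • u) := by
  have hne : ∀ g ∈ F, g q ≠ g (q + u) := fun g hg h => by
    have := (hE.isometry g hg).injective h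
    simp [hu0] at this
  -- The flat `g` contains the germs of both segments of direction `u`; seen in `g` they have
  -- directions `w₁ u` and `w₂ u`. At time `s` they are at distance at most `2 * ‖u₀ - u‖ * s`,
  -- through the common point `q + s • u₀`, so orbit separation forces `w₁ u = w₂ u`.
  obtain ⟨g, hg, hg1, hg2⟩ := hE.initial (f q) (f (q + u)) (f' q) (f' (q + u)) (hne f hf)
    (hne f' hf')
  obtain ⟨δ₁, h1, h1', hs1⟩ := hE.exists_initial hf hg1
  obtain ⟨δ₂, h2, h2', hs2⟩ := hE.exists_initial hf' hg2
  simp only [add_sub_cancel_left] at hs1 hs2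
  set s := min δ (min δ₁ δ₂) with hs
  have hspos : 0 < s := lt_min hδ (lt_min h1 h2)
  obtain ⟨p₁, hp₁⟩ := hs1 s hspos.le ((min_le_right _ _).trans (min_le_left _ _))
  obtain ⟨p₂, hp₂⟩ := hs2 s hspos.le ((min_le_right _ _).trans (min_le_right _ _))
  obtain ⟨p₀, hp₀⟩ := hs1 0 le_rfl h1.le
  rw [zero_smul, add_zero] at hp₀
  have hsu : f (q + s • u₀) = f' (q + s • u₀) := by
    have := hE.eq_on_segment hf hf' hq h₀ (t := s / δ) (by positivity)
      ((div_le_one hδ).2 (min_le_left _ _))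
    rwa [add_sub_cancel_left, smul_smul, div_mul_cancel₀ _ hδ.ne'] at this
  have hdist : dist (f (q + s • u)) (f' (q + s • u)) ≤ 2 * ‖u₀ - u‖ * s := by
    have h3 : dist (f (q + s • u)) (f (q + s • u₀)) = s * ‖u₀ - u‖ := by
      rw [hE.dist_eq hf, add_sub_add_left_eq_sub, ← smul_sub, norm_smul, Real.norm_of_nonneg hspos.le]
    have h4 : dist (f (q + s • u₀)) (f' (q + s • u)) = s * ‖u₀ - u‖ := by
      rw [hsu, hE.dist_eq hf', add_sub_add_left_eq_sub, ← smul_sub, norm_smul,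
        Real.norm_of_nonneg hspos.le, norm_sub_rev]
    have := dist_triangle (f (q + s • u)) (f (q + s • u₀)) (f' (q + s • u))
    linarith
  obtain ⟨w₁, hw₁, H₁⟩ := hE.exists_linear hf hg
  obtain ⟨w₂, hw₂, H₂⟩ := hE.exists_linear hf' hg
  have e1 := H₁ _ _ _ _ hp₀.symm hp₁.symm
  have e2 := H₂ _ _ _ _ (hq.symm.trans hp₀.symm) hp₂.symm
  rw [add_sub_cancel_left, map_smul] at e1 e2
  have e3 : ‖(w₂⁻¹ * w₁) u - u‖ * s ≤ 2 * ‖u₀ - u‖ * s := by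
    have e4 : w₂ ((w₂⁻¹ * w₁) u - u) = w₁ u - w₂ u := by
      rw [map_sub]
      change w₂ (w₂.symm (w₁ u)) - _ = _
      rw [w₂.apply_symm_apply]
    have e5 : p₁ - p₂ = s • (w₁ u - w₂ u) := by
      rw [smul_sub, ← e1, ← e2]; abel
    calc ‖(w₂⁻¹ * w₁) u - u‖ * s = dist (g p₂) (g p₁) := by
          rw [← w₂.norm_map, e4, hE.dist_eq hg, e5, norm_smul, Real.norm_of_nonneg hspos.le,
            mul_comm]
      _ ≤ _ := by rw [hp₁, hp₂, dist_comm]; exact hdist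
  have e6 : (w₂⁻¹ * w₁) u = u := hη _ (W.mul_mem (W.inv_mem hw₂) hw₁)
    ((le_of_mul_le_mul_right e3 hspos).trans_lt hclose)
  have e7 : w₁ u = w₂ u := by
    have : w₂ ((w₂⁻¹ * w₁) u) = w₁ u := w₂.apply_symm_apply (w₁ u)
    rw [← this, e6]
  have e8 : p₁ = p₂ := by
    rw [e7, ← e2] at e1
    exact sub_left_injective e1
  exact ⟨s, hspos, by rw [← hp₁, ← hp₂, e8]⟩

/-- The direction is moved linearly from `v` to `u`. Passing to a limit direction uses only the
separation of its own orbit; moving beyond a direction needs a separation uniform nearby, hence a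
trivial stabilizer. So `u` itself may be singular. -/
theorem IsEuclideanBuilding.agree_of_regular (hfin : (W : Set (A ≃ₗᵢ[ℝ] A)).Finite) {q v u : A}
    (hq : f q = f' q) (hv : f (q + v) = f' (q + v))
    (hreg : ∀ t : ℝ, 0 ≤ t → t < 1 → ∀ w ∈ W, w ((1 - t) • v + t • u) = (1 - t) • v + t • u → w = 1) :
    ∃ δ : ℝ, 0 < δ ∧ δ ≤ 1 ∧ ∀ s, 0 ≤ s → s ≤ δ → f (q + s • u) = f' (q + s • u) := by
  set d : ℝ → A := fun t => (1 - t) • v + t • u with hd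
  have hdc : Continuous d := by fun_prop
  have hclose : ∀ t : ℝ, ∀ ε > 0, ∃ ρ > 0, ∀ s, |s - t| < ρ → ‖d s - d t‖ < ε := by
    intro t ε hε
    obtain ⟨ρ, hρ, h⟩ := Metric.continuous_iff.1 hdc t ε hε
    exact ⟨ρ, hρ, fun s hs => by rw [← dist_eq_norm]; exact h s hs⟩
  have key : ∃ δ : ℝ, 0 < δ ∧ f (q + δ • d 1) = f' (q + δ • d 1) := by
    refine unitInterval_induction (fun t => ∃ δ : ℝ, 0 < δ ∧ f (q + δ • d t) = f' (q + δ • d t)) ?_ ?_ ?_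
    · exact ⟨1, one_pos, by simpa [hd] using hv⟩
    · intro t _ _ h
      by_cases h0 : d t = 0
      · exact ⟨1, one_pos, by simpa [h0] using hq⟩
      obtain ⟨η, hη, hsep⟩ := exists_orbit_separation hfin (d t)
      obtain ⟨ρ, hρ, hcl⟩ := hclose t (η / 2) (by positivity)
      obtain ⟨s, ⟨δ, hδ, hs⟩, -, hs1, hs2⟩ := h ρ hρ
      refine hE.agree_of_close hf hf' hδ h0 hq hs hsep ?_
      have := hcl s (by rw [abs_lt]; constructor <;> linarith)
      linarith
    · rintro t ht0 ht1 ⟨δ, hδ, h⟩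
      obtain ⟨η, hη, hsep⟩ := exists_uniform_orbit_separation hfin (hreg t ht0 ht1)
      obtain ⟨ρ, hρ, hcl⟩ := hclose t (η / 2) (by positivity)
      set s := t + min (ρ / 2) (1 - t) with hs
      have hmin : 0 < min (ρ / 2) (1 - t) := lt_min (by positivity) (by linarith)
      have hm1 := min_le_left (ρ / 2) (1 - t)
      have hm2 := min_le_right (ρ / 2) (1 - t)
      refine ⟨s, by linarith, by linarith, ?_⟩
      by_cases h0 : d s = 0
      · exact ⟨1, one_pos, by simpa [h0] using hq⟩
      have hc := hcl s (by rw [abs_lt]; constructor <;> linarith)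
      refine hE.agree_of_close hf hf' hδ h0 hq h (hsep (d s) (by simp only [hd] at hc ⊢; linarith)) ?_
      rw [norm_sub_rev]
      linarith
  obtain ⟨δ, hδ, h⟩ := key
  have hd1 : d 1 = u := by simp [hd]
  rw [hd1] at h
  refine ⟨min δ 1, lt_min hδ one_pos, min_le_right _ _, fun s hs0 hs1 => ?_⟩
  have := hE.eq_on_segment hf hf' hq h (t := s / δ) (by positivity)
    ((div_le_one hδ).2 (hs1.trans (min_le_left _ _)))
  rwa [add_sub_cancel_left, smul_smul, div_mul_cancel₀ _ hδ.ne'] at this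

variable {C D : Set A} (hD : IsChamberCone W C D)

include hD

/-- Two marked flats sharing a segment of regular direction share the germ of the chamber. -/
theorem IsEuclideanBuilding.agree_germ {q v u : A} (hv : v ∈ C) (hu : u ∈ D)
    (hq : f q = f' q) (hqv : f (q + v) = f' (q + v)) :
    ∃ δ : ℝ, 0 < δ ∧ δ ≤ 1 ∧ ∀ s, 0 ≤ s → s ≤ δ → f (q + s • u) = f' (q + s • u) :=
  hE.agree_of_regular hf hf' hD.finite hq hqv fun t ht0 ht1 _ hw h =>
    hD.stabilizer (hD.add_mem_left (hD.smul_mem_left (by linarith) hv) (hD.smul_mem ht0 hu)) hw h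

theorem IsEuclideanBuilding.agree_germ_neg {q v u : A} (hv : v ∈ C) (hu : u ∈ D)
    (hq : f q = f' q) (hqv : f (q - v) = f' (q - v)) :
    ∃ δ : ℝ, 0 < δ ∧ δ ≤ 1 ∧ ∀ s, 0 ≤ s → s ≤ δ → f (q - s • u) = f' (q - s • u) := by
  rw [sub_eq_add_neg] at hqv
  obtain ⟨δ, h0, h1, h⟩ := hE.agree_of_regular hf hf' hD.finite (u := -u) hq hqv
    fun t ht0 ht1 w hw h => by
      refine hD.stabilizer (hD.add_mem_left (hD.smul_mem_left (t := 1 - t) (by linarith) hv)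
        (hD.smul_mem ht0 hu)) hw ?_
      rw [smul_neg, smul_neg, ← neg_add, map_neg, neg_inj] at h
      exact h
  exact ⟨δ, h0, h1, fun s hs0 hs1 => by simpa [sub_eq_add_neg] using h s hs0 hs1⟩

/-- Two marked flats that agree at `a` and `b` agree on the Weyl hull `(a + D) ∩ (b - D)`. -/
theorem IsEuclideanBuilding.agree_hull {a b p : A} (ha : f a = f' a) (hb : f b = f' b)
    (hap : p - a ∈ D) (hpb : b - p ∈ D) : f p = f' p := by
  have hab : b - a = (p - a) + (b - p) := by abel
  have hcf := (hE.isometry f hf).continuous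
  have hcf' := (hE.isometry f' hf').continuous
  by_cases hC : b - a ∈ C
  -- On the way from `a` to `p`, the vector from the current point to `b` stays in `C`. The flats
  -- agree at both points, so they share the chamber germ there, which contains the direction `p -
  -- a`.
  · have main : ∀ p, p - a ∈ D → b - p ∈ C → f p = f' p := by
      intro p hp hpC
      have := unitInterval_induction (fun t => f (a + t • (p - a)) = f' (a + t • (p - a)))
        (by simpa using ha) ?_ ?_
      · simpa using this
      · intro t _ _ h
        have hcl : IsClosed {t : ℝ | f (a + t • (p - a)) = f' (a + t • (p - a))} :=
          isClosed_eq (hcf.comp (by fun_prop)) (hcf'.comp (by fun_prop))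
        change t ∈ {t : ℝ | f (a + t • (p - a)) = f' (a + t • (p - a))}
        rw [← hcl.closure_eq, Metric.mem_closure_iff]
        intro ε hε
        obtain ⟨s, hs, -, h1, h2⟩ := h ε hε
        exact ⟨s, hs, by rw [Real.dist_eq, abs_lt]; constructor <;> linarith⟩
      · intro t ht0 ht1 ht
        have hv : b - (a + t • (p - a)) ∈ C := by
          rw [show b - (a + t • (p - a)) = (b - p) + (1 - t) • (p - a) by module]
          exact hD.add_mem_left hpC (hD.smul_mem (by linarith) hp)
        obtain ⟨δ, h0, h1, h⟩ := hE.agree_germ hf hf' hD hv hp ht (by simpa using hb)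
        have hmin : 0 < min δ (1 - t) := lt_min h0 (by linarith)
        have hm := min_le_right δ (1 - t)
        refine ⟨t + min δ (1 - t), by linarith, by linarith, ?_⟩
        have := h (min δ (1 - t)) hmin.le (min_le_left _ _)
        rwa [add_assoc, ← add_smul] at this
    -- A general `p` is the limit of points moved slightly towards `a`, to which `main` applies.
    have hcl : IsClosed {s : ℝ | f ((1 - s) • p + s • a) = f' ((1 - s) • p + s • a)} :=
      isClosed_eq (hcf.comp (by fun_prop)) (hcf'.comp (by fun_prop))
    have h0 : (0 : ℝ) ∈ {s : ℝ | f ((1 - s) • p + s • a) = f' ((1 - s) • p + s • a)} := by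
      refine hcl.mem_of_tendsto (b := 𝓝[>] (0 : ℝ)) (f := fun s => s) nhdsWithin_le_nhds ?_
      filter_upwards [Ioo_mem_nhdsGT one_pos] with s hs
      refine main _ ?_ ?_
      · rw [show (1 - s) • p + s • a - a = (1 - s) • (p - a) by module]
        exact hD.smul_mem (by linarith [hs.2]) hap
      · rw [show b - ((1 - s) • p + s • a) = s • (b - a) + (1 - s) • (b - p) by module]
        exact hD.add_mem_left (hD.smul_mem_left hs.1 hC) (hD.smul_mem (by linarith [hs.2]) hpb)
    simpa using h0
  · have hs : IsSingular W (b - a) := by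
      by_contra h
      exact hC (hD.regular (hab ▸ hD.add_mem hap hpb) h)
    obtain ⟨t, h0, h1, ht⟩ := hD.singular hap hpb (hab ▸ hs)
    rw [← hab] at ht
    have := hE.eq_on_segment hf hf' ha hb h0 h1
    rwa [← ht, add_sub_cancel] at this

theorem IsEuclideanBuilding.vector_unique {a b a' b' : A} (ha : f a = f' a') (hb : f b = f' b')
    (hab : b - a ∈ D) (hab' : b' - a' ∈ D) : b' - a' = b - a := by
  obtain ⟨w, hw, h⟩ := hE.exists_linear hf hf'
  rw [h _ _ _ _ ha hb] at hab' ⊢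
  exact hD.unique hab hw hab'

/-- Translating the parameter so that two marked flats agree at two common points. -/
theorem IsEuclideanBuilding.exists_translate {a b a' b' : A} (ha : f a = f' a') (hb : f b = f' b')
    (hab : b - a ∈ D) (hab' : b' - a' ∈ D) :
    ∃ g ∈ F, g a = f a ∧ g b = f b ∧ ∀ v, g (b + v) = f' (b' + v) := by
  have h := hE.vector_unique hf hf' hD ha hb hab hab'
  have hg : f' ∘ (fun x => (1 : A ≃ₗᵢ[ℝ] A) x + (a' - a)) ∈ F :=
    hE.precomp f' hf' _ (affineWeyl_apply_mem W.one_mem _)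
  have h1 : ∀ x, (f' ∘ (fun x => (1 : A ≃ₗᵢ[ℝ] A) x + (a' - a))) x = f' (x + (a' - a)) :=
    fun x => rfl
  have h2 : ∀ v, b + v + (a' - a) = b' + v := fun v => by
    rw [show b + v + (a' - a) = (b - a) + a' + v by abel, ← h]; abel
  refine ⟨_, hg, ?_, ?_, fun v => ?_⟩
  · rw [h1, ha]; congr 1; abel
  · rw [h1, hb]; congr 1; simpa using h2 0
  · rw [h1, h2]

end flats

end Building

/-! ### From opposite directions to a common flat -/

section Building

variable {A : Type*} [NormedAddCommGroup A] [InnerProductSpace ℝ A]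
variable {E : Type*} [MetricSpace E] {W : Subgroup (A ≃ₗᵢ[ℝ] A)} {F : Set (A → E)}
variable {C D : Set A}

/-- Initial parts of the segments `[y, x]` and `[y, z]` lie in a common marked flat, with directions
in `-D` and in `D`. -/
def LocallyOpposite (D : Set A) (F : Set (A → E)) (y x z : E) : Prop :=
  ∃ f ∈ F, ∃ b u v : A, u ∈ D ∧ v ∈ D ∧ u ≠ 0 ∧ v ≠ 0 ∧ f b = y ∧
    f (b - u) ∈ segm y x ∧ f (b + v) ∈ segm y z

variable (hE : IsEuclideanBuilding W F) (hD : IsChamberCone W C D)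

include hE in
theorem IsEuclideanBuilding.exists_mem_image {x y : E} {S : Set E} {f : A → E} {T : Set A}
    (hf0 : f 0 = x) (hyx : y ≠ x) (h : GermLE x (segm x y) S)
    (hS : GermEq x S (f '' T)) : ∃ u ∈ T, u ≠ 0 ∧ f u ∈ segm x y := by
  -- Applied to a segment and its reverse, `initial` yields a flat through both endpoints.
  obtain ⟨h', hh', hx', hy'⟩ := hE.initial x y y x hyx.symm hyx
  obtain ⟨a, rfl⟩ := hx'.self_of_nhds (left_mem_segm _ _)
  obtain ⟨b, rfl⟩ := hy'.self_of_nhds (left_mem_segm _ _)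
  have hle : GermLE (h' a) (segm (h' a) (h' b)) (f '' T) := by
    filter_upwards [h, hS] with z h1 h2 h3
    exact h2.1 (h1 h3)
  obtain ⟨δ, h0, h1, hδ⟩ := hE.exists_initial hh' hle
  obtain ⟨u, hu, hfu⟩ := hδ δ h0.le le_rfl
  refine ⟨u, hu, fun hu0 => ?_, by rw [hfu]; exact hE.lineMap_mem_segm hh' a b h0.le h1⟩
  rw [hu0, hf0] at hfu
  have := (hE.isometry h' hh').injective hfu
  rw [left_eq_add, smul_eq_zero, sub_eq_zero] at this
  rcases this with h | h
  · exact h0.ne' h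
  · exact hyx (by rw [h])

include hE in
theorem COpposite.locallyOpposite (hD : IsChamberCone W C (closure C)) {y x z : E}
    (h : COpposite C F y x z) : LocallyOpposite (closure C) F y x z := by
  obtain ⟨hx, hz, S, T, -, -, ⟨f, hf, hf0, hS, hT⟩, hxS, hzT⟩ := h
  obtain ⟨u, hu, hu0, hux⟩ := hE.exists_mem_image hf0 hx hxS hS
  obtain ⟨v, hv, hv0, hvz⟩ := hE.exists_mem_image hf0 hz hzT hT
  rw [Set.mem_neg] at hv
  -- `OppositeAt` places `x` on the side of `D`, `LocallyOpposite` on the side of `-D`; the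
  -- opposition element of `W` exchanges them.
  obtain ⟨w, hw, hwD⟩ := hD.exists_opposite
  have hg : f ∘ (fun a => w a + 0) ∈ F := hE.precomp f hf _ (affineWeyl_apply_mem hw 0)
  have happ : ∀ a, (f ∘ (fun a => w a + 0)) a = f (w a) := fun a => by simp
  refine ⟨_, hg, 0, -(w.symm u), w.symm v, ?_, ?_, by simpa using hu0, by simpa using hv0, ?_, ?_, ?_⟩
  · rw [hwD]; simpa using hu
  · rw [hwD]; simpa using hv
  · rw [happ, map_zero, hf0]
  · rw [happ]; simpa using hux
  · rw [happ]; simpa using hvz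

include hD in
-- Every element of `W` fixes `0`, so `0 ∈ C` would make `W` trivial and `D` the whole space, which
-- is not pointed once `u ≠ 0` exists.
theorem IsChamberCone.ne_zero {c u : A} (hc : c ∈ C) (hu : u ≠ 0) : c ≠ 0 := by
  rintro rfl
  obtain ⟨w, hw, h⟩ := hD.exists_opposite
  obtain ⟨w', hw', h'⟩ := hD.exists_mem u
  have h1 := hD.stabilizer hc hw (map_zero w)
  have h2 := hD.stabilizer hc hw' (map_zero w')
  subst h1 h2
  exact hu (hD.pointed h' ((h u).1 h'))

include hE in
/-- A marked flat containing `x` and the initial part of a segment of another marked flat `f`. -/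
theorem IsEuclideanBuilding.exists_flat_of_germ {f : A → E} (hf : f ∈ F) {b v : A} (hv : v ≠ 0)
    {x x' : E} (hx : x ≠ x') : ∃ g ∈ F, GermLE x (segm x x') (range g) ∧ g b = f b ∧
      (∀ p q, f p = g q → p = q) ∧
      ∃ δ : ℝ, 0 < δ ∧ δ ≤ 1 ∧ ∀ s, 0 ≤ s → s ≤ δ → g (b + s • v) = f (b + s • v) := by
  have hne : f b ≠ f (b + v) := fun h => hv (by simpa using (hE.isometry f hf).injective h)
  obtain ⟨g₀, hg₀, h1, h2⟩ := hE.initial _ _ _ _ hne hx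
  obtain ⟨g, hg, hr, hn⟩ := hE.exists_normalized hf hg₀
  rw [← hr] at h1 h2
  obtain ⟨δ, h3, h4, h5⟩ := hE.exists_initial hf h1
  have key : ∀ s, 0 ≤ s → s ≤ δ → g (b + s • v) = f (b + s • v) := by
    intro s hs hs'
    obtain ⟨q, hq⟩ := h5 s hs hs'
    rw [add_sub_cancel_left] at hq
    rw [hn _ _ hq.symm, hq, hn _ _ hq.symm]
  refine ⟨g, hg, h2, by simpa using key 0 le_rfl h3.le, hn, δ, h3, h4, key⟩

include hE hD in
/-- If the directions at `y` of `x` and `z` are opposite, then `x`, `y` and an initial part of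
`[y, z]` lie in a common marked flat. -/
theorem LocallyOpposite.exists_initial {y x z : E} (h : LocallyOpposite D F y x z) :
    ∃ f ∈ F, ∃ a b v : A, f a = x ∧ f b = y ∧ b - a ∈ D ∧ v ∈ D ∧ v ≠ 0 ∧
      f (b + v) ∈ segm y z := by
  obtain ⟨f, hf, b, u, v, hu, hv, hu0, hv0, rfl, hux, hvz⟩ := h
  obtain ⟨c, hc⟩ := hD.nonempty
  have hc0 : c ≠ 0 := hD.ne_zero hc hv0
  have hxy : x ≠ f b := by
    rintro rfl
    obtain ⟨t, -, -, h⟩ := hE.exists_of_mem_segm hf hux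
    have := (hE.isometry f hf).injective h
    simp [hu0] at this
  -- Sharing a germ in the regular direction `c` instead of `v` makes `g` share the whole chamber
  -- germ with `f`, in particular an initial part of `[y, z]`.
  obtain ⟨g, hg, hgx, hgb, hn, δ, h0, -, hδ⟩ := hE.exists_flat_of_germ hf (b := b) hc0 hxy
  obtain ⟨a, rfl⟩ := hgx.self_of_nhds (left_mem_segm _ _)
  obtain ⟨δ', h0', h1', hδ'⟩ := hE.agree_germ hg hf hD (hD.smul_mem_left h0 hc) hv hgb
    (hδ δ h0.le le_rfl)
  refine ⟨g, hg, a, b, δ' • v, rfl, hgb, ?_, hD.smul_mem h0'.le hv, ?_, ?_⟩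
  · rw [← hgb] at hux
    obtain ⟨t, ht0, ht1, h⟩ := hE.exists_of_mem_segm hg hux
    have h2 := hn _ _ h
    have h3 : u = t • (b - a) := by
      have : u = -(b - u - b) := by abel
      rw [this, h2]
      module
    have ht : t ≠ 0 := by
      rintro rfl
      exact hu0 (by simpa using h3)
    have : b - a = t⁻¹ • u := by rw [h3, inv_smul_smul₀ ht]
    rw [this]
    exact hD.smul_mem (inv_nonneg.2 ht0) hu
  · exact smul_ne_zero h0'.ne' hv0
  · rw [hδ' δ' h0'.le le_rfl]
    refine mem_segm_trans ?_ hvz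
    have := hE.lineMap_mem_segm hf b (b + v) h0'.le h1'
    rwa [add_sub_cancel_left] at this

include hE hD in
/-- If the path `x, y, ζ` goes through `f a, f b, f c` in the direction of `D` and `ζ ∈ [y, z]`, then
the directions at `ζ` of `x` and `z` are opposite. -/
theorem IsEuclideanBuilding.locallyOpposite_of_mem_segm {f : A → E} (hf : f ∈ F) {a b c : A} {z : E}
    (hab : b - a ∈ D) (hbc : c - b ∈ D) (hcb : c ≠ b) (hζ : f c ∈ segm (f b) z) (hz : z ≠ f c) :
    LocallyOpposite D F (f c) (f a) z := by
  obtain ⟨k, hk⟩ := hD.nonempty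
  have hcb0 : c - b ≠ 0 := sub_ne_zero.2 hcb
  have hk0 : -k ≠ 0 := neg_ne_zero.2 (hD.ne_zero hk hcb0)
  have hca : c - a ∈ D := by
    rw [show c - a = (c - b) + (b - a) by abel]
    exact hD.add_mem hbc hab
  have hca0 : c - a ≠ 0 := fun h => hcb0 (hD.pointed hbc (by
    rw [show -(c - b) = (b - a) - (c - a) by abel, h, sub_zero]
    exact hab))
  -- The regular direction `-k` makes `g` share the germ of `c - D` with `f`, hence the directions
  -- of both `a` and `b`. As `f c` is between `f b` and `z`, the direction of `z` in `g` is a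
  -- positive multiple of `c - b`.
  obtain ⟨g, hg, hgz, hgc, hn, δ, h0, h1, hδ⟩ := hE.exists_flat_of_germ hf (b := c) hk0 hz.symm
  have hδk : g (c - δ • k) = f (c - δ • k) := by simpa [sub_eq_add_neg] using hδ δ h0.le le_rfl
  obtain ⟨δ₁, p1, q1, hδ₁⟩ := hE.agree_germ_neg hg hf hD (hD.smul_mem_left h0 hk) hbc hgc hδk
  obtain ⟨δ₂, p2, q2, hδ₂⟩ := hE.agree_germ_neg hg hf hD (hD.smul_mem_left h0 hk) hca hgc hδk
  obtain ⟨h, hh, hhc, hhz⟩ := hE.initial (f c) z z (f c) hz.symm hz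
  obtain ⟨e, he⟩ := hhc.self_of_nhds (left_mem_segm _ _)
  obtain ⟨e', rfl⟩ := hhz.self_of_nhds (left_mem_segm _ _)
  rw [← he] at hgz
  obtain ⟨δ₃, p3, q3, hδ₃⟩ := hE.exists_initial hh hgz
  obtain ⟨m, hm⟩ := hδ₃ δ₃ p3.le le_rfl
  have hseg : g m ∈ segm (f c) (h e') := by
    rw [hm, ← he]
    exact hE.lineMap_mem_segm hh e e' p3.le q3
  have hmc : m - c ≠ 0 := by
    intro h2
    rw [sub_eq_zero.1 h2, hgc, ← he] at hm
    have := (hE.isometry h hh).injective hm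
    rw [left_eq_add, smul_eq_zero, sub_eq_zero] at this
    rcases this with h2 | h2
    · exact p3.ne' h2
    · exact hz (by rw [h2, he])
  refine ⟨g, hg, c, δ₂ • (c - a), m - c, hD.smul_mem p2.le hca, ?_, smul_ne_zero p2.ne' hca0, hmc,
    hgc, ?_, by rwa [add_sub_cancel]⟩
  · have h2 : f (c - δ₁ • (c - b)) ∈ segm (f b) (f c) := by
      rw [mem_segm_comm]
      have := hE.lineMap_mem_segm hf c b p1.le q1
      rwa [show c + δ₁ • (b - c) = c - δ₁ • (c - b) by module] at this
    have h3 : f c ∈ segm (f b) (g m) := by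
      rw [mem_segm_comm]
      exact mem_segm_of_mem_of_mem (mem_segm_comm.1 hseg) (mem_segm_comm.1 hζ)
    have h4 := mem_segm_of_mem_of_mem h2 h3
    rw [← hδ₁ δ₁ p1.le le_rfl, ← hgc] at h4
    obtain ⟨t, ht0, ht1, h5⟩ := hE.exists_of_mem_segm hg h4
    have h6 := (hE.isometry g hg).injective h5
    have h7 : t • (m - c) = ((1 - t) * δ₁) • (c - b) := by
      have : t • (m - c) = (c - δ₁ • (c - b) + t • (m - (c - δ₁ • (c - b))) - c) +
        ((1 - t) * δ₁) • (c - b) := by module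
      rw [this, ← h6]
      simp
    have ht : t ≠ 0 := by
      rintro rfl
      rw [zero_smul, sub_zero, one_mul] at h7
      exact smul_ne_zero p1.ne' hcb0 h7.symm
    rw [← inv_smul_smul₀ ht (m - c), h7]
    have : 0 ≤ 1 - t := by linarith
    exact hD.smul_mem (by positivity) (hD.smul_mem (by positivity) hbc)
  · rw [hδ₂ δ₂ p2.le le_rfl]
    have := hE.lineMap_mem_segm hf c a p2.le q2
    rwa [show c + δ₂ • (a - c) = c - δ₂ • (c - a) by module] at this

include hE hD in
/-- Any two points lie in a marked flat, on a segment with direction in `D`. -/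
theorem IsEuclideanBuilding.exists_flat [Nontrivial A] (x y : E) :
    ∃ f ∈ F, ∃ a b : A, f a = x ∧ f b = y ∧ b - a ∈ D := by
  have main : ∃ f ∈ F, ∃ a b : A, f a = x ∧ f b = y := by
    by_cases hxy : x = y
    · subst hxy
      obtain ⟨f₀, hf₀⟩ := hE.nonempty
      obtain ⟨a, b, hab⟩ := exists_pair_ne A
      have : ∃ x', x ≠ x' := by
        by_contra! h
        exact hab ((hE.isometry f₀ hf₀).injective ((h _).symm.trans (h _)))
      obtain ⟨x', hx'⟩ := this
      obtain ⟨f, hf, h1, -⟩ := hE.initial x x' x x' hx' hx'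
      obtain ⟨a, ha⟩ := h1.self_of_nhds (left_mem_segm _ _)
      exact ⟨f, hf, a, a, ha, ha⟩
    · obtain ⟨f, hf, h1, h2⟩ := hE.initial x y y x hxy (Ne.symm hxy)
      obtain ⟨a, ha⟩ := h1.self_of_nhds (left_mem_segm _ _)
      obtain ⟨b, hb⟩ := h2.self_of_nhds (left_mem_segm _ _)
      exact ⟨f, hf, a, b, ha, hb⟩
  obtain ⟨f, hf, a, b, rfl, rfl⟩ := main
  obtain ⟨w, hw, hwD⟩ := hD.exists_mem (b - a)
  have happ : ∀ a, (f ∘ (fun a => (w⁻¹ : A ≃ₗᵢ[ℝ] A) a + 0)) (w a) = f a := fun a => by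
    change f (w.symm (w a) + 0) = f a
    simp
  refine ⟨_, hE.precomp f hf _ (affineWeyl_apply_mem (W.inv_mem hw) 0), w a, w b, happ a, happ b, ?_⟩
  rwa [← map_sub]

include hE hD in
/-- If the directions at `y` of `x` and `z` are opposite, then `x, y, z` lie in a common marked flat,
in directions belonging to `D`. -/
theorem LocallyOpposite.exists_flat {y x z : E} (h : LocallyOpposite D F y x z) :
    ∃ f ∈ F, ∃ a b c : A, f a = x ∧ f b = y ∧ f c = z ∧ b - a ∈ D ∧ c - b ∈ D := by
  obtain ⟨f₁, hf₁, a₁, b₁, v₁, ha₁, hb₁, hab₁, hv₁, hv₁0, hv₁z⟩ := h.exists_initial hE hD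
  have : Nontrivial A := ⟨v₁, 0, hv₁0⟩
  obtain ⟨h₀, hh₀, e, e', he, he', -⟩ := hE.exists_flat hD y z
  have hinj := (hE.isometry h₀ hh₀).injective
  have hee : e' - e ≠ 0 := by
    intro h
    rw [← he', sub_eq_zero.1 h, he, ← hb₁] at hv₁z
    obtain ⟨t, -, -, ht⟩ := hE.exists_of_mem_segm hf₁ hv₁z
    have := (hE.isometry f₁ hf₁).injective ht
    simp [hv₁0] at this
  have hζmem : ∀ t : ℝ, 0 ≤ t → t ≤ 1 → h₀ (e + t • (e' - e)) ∈ segm y z := by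
    intro t h0 h1
    rw [← he, ← he']
    exact hE.lineMap_mem_segm hh₀ e e' h0 h1
  have hζne : ∀ t s : ℝ, t ≠ s → h₀ (e + t • (e' - e)) ≠ h₀ (e + s • (e' - e)) := by
    intro t s hts h
    have := hinj h
    rw [add_right_inj] at this
    exact hts (smul_left_injective ℝ hee this)
  have hend : h₀ (e + (1 : ℝ) • (e' - e)) = z := by rw [one_smul, add_sub_cancel, he']
  have hstart : h₀ (e + (0 : ℝ) • (e' - e)) = y := by rw [zero_smul, add_zero, he]
  have key := unitInterval_induction (fun t => ∃ f ∈ F, ∃ a b c : A, f a = x ∧ f b = y ∧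
    f c = h₀ (e + t • (e' - e)) ∧ b - a ∈ D ∧ c - b ∈ D) ?_ ?_ ?_
  · obtain ⟨f, hf, a, b, c, h1, h2, h3, h4, h5⟩ := key
    exact ⟨f, hf, a, b, c, h1, h2, h3.trans hend, h4, h5⟩
  · exact ⟨f₁, hf₁, a₁, b₁, b₁, ha₁, hb₁, by rw [hb₁, hstart], hab₁,
      by rw [sub_self]; exact hD.zero_mem⟩
  · intro t ht0 ht1 hT
    set ζ := h₀ (e + t • (e' - e)) with hζ
    have hζy : ζ ≠ y := by
      rw [← hstart]
      exact hζne _ _ ht0.ne'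
    by_cases hxy : x = y
    · obtain ⟨f, hf, a, b, h1, h2, h3⟩ := hE.exists_flat hD y ζ
      exact ⟨f, hf, a, a, b, h1.trans hxy.symm, h1, h2, by rw [sub_self]; exact hD.zero_mem, h3⟩
    -- Closedness: a flat through `x` and the germ at `ζ` of `[ζ, y]` contains an earlier good
    -- point. It agrees with the flat of that point on a Weyl hull containing `y`.
    obtain ⟨g₀, hg₀, hg1, hg2⟩ := hE.initial ζ y x y hζy hxy
    have hζe : y = h₀ e := he.symm
    rw [hζe] at hg1
    obtain ⟨δ, p, q, hδ⟩ := hE.exists_initial hh₀ hg1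
    obtain ⟨s, ⟨f, hf, a, b, c, ha, hb, hc, hab, hbc⟩, hs0, hs1, hs2⟩ :=
      hT (δ * t) (by positivity)
    have hspos : 0 < s := by nlinarith
    obtain ⟨g, hg, hr, hn⟩ := hE.exists_normalized hf hg₀
    obtain ⟨a', ha'⟩ : x ∈ range g := hr ▸ hg2.self_of_nhds (left_mem_segm _ _)
    obtain ⟨d, hd⟩ : ζ ∈ range g := hr ▸ hg1.self_of_nhds (left_mem_segm _ _)
    obtain ⟨c', hc'⟩ : h₀ (e + s • (e' - e)) ∈ range g := by
      have := hδ (1 - s / t) (by rw [sub_nonneg, div_le_one ht0]; exact hs2.le)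
        (by rw [sub_le_iff_le_add, ← sub_le_iff_le_add', le_div_iff₀ ht0]; linarith)
      rw [hr]
      convert this using 2
      have h2 : s = (1 - (1 - s / t)) * t := by field_simp; ring
      nth_rewrite 1 [h2]
      module
    obtain rfl := hn a a' (ha.trans ha'.symm)
    obtain rfl := hn c c' (hc.trans hc'.symm)
    have hgb : f b = g b := hE.agree_hull hf hg hD (ha.trans ha'.symm) (hc.trans hc'.symm) hab hbc
    refine ⟨g, hg, a, b, d, ha', hgb.symm.trans hb, hd, hab, ?_⟩
    have hmem : h₀ (e + s • (e' - e)) ∈ segm y ζ := by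
      have := hE.lineMap_mem_segm hh₀ e (e + t • (e' - e)) (t := s / t) (by positivity)
        ((div_le_one ht0).2 hs2.le)
      rwa [add_sub_cancel_left, smul_smul, div_mul_cancel₀ _ ht0.ne', he] at this
    rw [← hc', ← hb, hgb, ← hd] at hmem
    obtain ⟨r, hr0, hr1, hrc⟩ := hE.exists_of_mem_segm hg hmem
    have h2 := (hE.isometry g hg).injective hrc
    have h3 : c - b = r • (d - b) := by rw [h2]; abel
    have hr : r ≠ 0 := by
      rintro rfl
      rw [zero_smul, sub_eq_zero] at h3
      rw [h3, hb, ← hstart] at hc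
      exact hζne _ _ hspos.ne hc
    rw [← inv_smul_smul₀ hr (d - b), ← h3]
    exact hD.smul_mem (by positivity) hbc
  · rintro t ht0 ht1 ⟨f, hf, a, b, c, ha, hb, hc, hab, hbc⟩
    -- Openness: opposition persists at the current point, so a flat contains it with `x` and a
    -- further piece of the segment; `y` follows by the Weyl hull.
    have hopp : LocallyOpposite D F (f c) x z := by
      rcases ht0.eq_or_lt with rfl | hpos
      · rwa [hc, hstart]
      · rw [← ha]
        refine hE.locallyOpposite_of_mem_segm hD hf hab hbc ?_ ?_ ?_
        · rintro rfl
          rw [hb, ← hstart] at hc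
          exact hζne _ _ hpos.ne hc
        · rw [hb, hc]
          exact hζmem t ht0 ht1.le
        · rw [hc, ← hend]
          exact hζne _ _ ht1.ne'
    obtain ⟨f₂, hf₂, a₂, b₂, v, ha₂, hb₂, hab₂, hv, hv0, hvz⟩ := hopp.exists_initial hE hD
    have hca : c - a ∈ D := by
      rw [show c - a = (c - b) + (b - a) by abel]
      exact hD.add_mem hbc hab
    obtain ⟨g, hg, hga, hgc, hgv⟩ := hE.exists_translate hf hf₂ hD (ha.trans ha₂.symm) hb₂.symm
      hca hab₂
    have hgb : g b = f b := hE.agree_hull hg hf hD hga hgc hab hbc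
    rw [← hgv, hc, ← hend] at hvz
    obtain ⟨s, hs0, hs1, hs⟩ := hE.exists_of_mem_segm hh₀ hvz
    have hs' : g (c + v) = h₀ (e + (t + s * (1 - t)) • (e' - e)) := by
      rw [hs]; congr 1; module
    have hspos : 0 < s := by
      refine lt_of_le_of_ne hs0 ?_
      rintro rfl
      rw [zero_mul, add_zero, ← hc, ← hgc] at hs'
      have := (hE.isometry g hg).injective hs'
      simp [hv0] at this
    have h1 : 0 < s * (1 - t) := mul_pos hspos (by linarith)
    refine ⟨t + s * (1 - t), by linarith, by nlinarith, g, hg, a, b, c + v, hga.trans ha,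
      hgb.trans hb, hs', hab, ?_⟩
    rw [show c + v - b = (c - b) + v by abel]
    exact hD.add_mem hbc hv

end Building

/-! ### Prolonging chains, and the resulting piecewise affine path -/

section Building

variable {A : Type*} [NormedAddCommGroup A] [InnerProductSpace ℝ A]
variable {E : Type*} [MetricSpace E] {W : Subgroup (A ≃ₗᵢ[ℝ] A)} {F : Set (A → E)}
variable {C D : Set A}

/-- The points `x m, …, x n` are the images of `a m, …, a n` by the marked flat `f`, with successive
differences in `D`. -/
def IsChainIn (D : Set A) (f : A → E) (a : ℤ → A) (x : ℤ → E) (m n : ℤ) : Prop :=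
  (∀ p, m ≤ p → p ≤ n → f (a p) = x p) ∧ ∀ p, m ≤ p → p < n → a (p + 1) - a p ∈ D

variable (hE : IsEuclideanBuilding W F) (hD : IsChamberCone W C D)

omit [MetricSpace E] in
include hD in
theorem IsChainIn.sub_mem {f : A → E} {a : ℤ → A} {x : ℤ → E} {m n : ℤ}
    (h : IsChainIn D f a x m n) {p q : ℤ} (hp : m ≤ p) (hpq : p ≤ q) (hq : q ≤ n) :
    a q - a p ∈ D := by
  induction q, hpq using Int.leInduction with
  | base => rw [sub_self]; exact hD.zero_mem
  | succ q hpq ih =>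
    rw [← sub_add_sub_cancel (a (q + 1)) (a q) (a p)]
    exact hD.add_mem (h.2 q (hp.trans hpq) (by omega)) (ih (by omega))

include hE hD in
/-- A chain can be prolonged if the directions at its endpoint of its origin and of the new point
are opposite. -/
theorem IsChainIn.exists_succ {f : A → E} (hf : f ∈ F) {a : ℤ → A} {x : ℤ → E} {m n : ℤ}
    (h : IsChainIn D f a x m n) (hmn : m ≤ n)
    (hopp : LocallyOpposite D F (x n) (x m) (x (n + 1))) :
    ∃ g ∈ F, ∃ b : ℤ → A, IsChainIn D g b x m (n + 1) := by
  obtain ⟨f₁, hf₁, a₁, b₁, c₁, h1, h2, h3, hab, hbc⟩ := hopp.exists_flat hE hD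
  have hm := h.1 m le_rfl hmn
  have hn := h.1 n hmn le_rfl
  obtain ⟨g, hg, hgm, hgn, hgv⟩ := hE.exists_translate hf hf₁ hD (hm.trans h1.symm)
    (hn.trans h2.symm) (h.sub_mem hD le_rfl hmn le_rfl) hab
  have heq : ∀ p ≤ n, Function.update a (n + 1) (a n + (c₁ - b₁)) p = a p := fun p hp =>
    Function.update_of_ne (by omega) _ _
  refine ⟨g, hg, Function.update a (n + 1) (a n + (c₁ - b₁)), fun p hp hp' => ?_,
    fun p hp hp' => ?_⟩
  · rcases (show p ≤ n ∨ p = n + 1 by omega) with hpn | rfl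
    -- The old points lie in the Weyl hull of `x m` and `x n`, so they keep their coordinates.
    · rw [heq p hpn, ← h.1 p hp hpn]
      exact hE.agree_hull hg hf hD hgm hgn (h.sub_mem hD le_rfl hp hpn)
        (h.sub_mem hD hp hpn le_rfl)
    · rw [Function.update_self, hgv, add_sub_cancel, h3]
  · rcases (show p < n ∨ p = n by omega) with hpn | rfl
    · rw [heq p hpn.le, heq (p + 1) (by omega)]
      exact h.2 p hp hpn
    · rw [Function.update_self, heq p le_rfl, add_sub_cancel_left]
      exact hbc

include hE hD in
/-- If `x, y, z` go through `f a, f b, f c` in directions of `D`, with `z - y` regular, then a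
direction at `f c` that is opposite to that of `f b` is opposite to that of `f a`. -/
theorem LocallyOpposite.of_regular {f : A → E} (hf : f ∈ F) {a b c : A} {z : E}
    (hab : b - a ∈ D) (hbc : c - b ∈ C) (h : LocallyOpposite D F (f c) (f b) z) :
    LocallyOpposite D F (f c) (f a) z := by
  obtain ⟨g₀, hg₀, b₀, u₀, v, hu₀, hv, hu0, hv0, hgc, hgu, hgv⟩ := h
  obtain ⟨t, ht0, ht1, ht⟩ := hE.exists_of_mem_segm hf hgu
  have htne : t ≠ 0 := by
    rintro rfl
    rw [zero_smul, add_zero, ← hgc] at ht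
    have := (hE.isometry g₀ hg₀).injective ht
    simp [hu0] at this
  have htpos : 0 < t := lt_of_le_of_ne ht0 htne.symm
  have hpt : c - (c + t • (b - c)) = t • (c - b) := by module
  have hreg : c - (c + t • (b - c)) ∈ C := hpt ▸ hD.smul_mem_left htpos hbc
  obtain ⟨g, hg, hg1, hg2, hg3⟩ := hE.exists_translate hf hg₀ hD ht.symm hgc.symm
    (hD.subset hreg) (by simpa using hu₀)
  have hca : c - a ∈ C := by
    rw [show c - a = (c - b) + (b - a) by abel]
    exact hD.add_mem_left hbc hab
  -- Sharing a regular segment ending at `c`, the flats share the germ of `c - D`, which contains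
  -- the direction of `a`.
  obtain ⟨δ, p, q, hδ⟩ := hE.agree_germ_neg hg hf hD hreg (hD.subset hca) hg2
    (by simpa using hg1)
  refine ⟨g, hg, c, δ • (c - a), v, hD.smul_mem p.le (hD.subset hca), hv,
    smul_ne_zero p.ne' (hD.ne_zero hca hu0), hv0, hg2, ?_, by rwa [hg3]⟩
  rw [hδ δ p.le le_rfl]
  have := hE.lineMap_mem_segm hf c a p.le q
  rwa [show c + δ • (a - c) = c - δ • (c - a) by module] at this

include hE in
theorem IsEuclideanBuilding.exists_isChainIn [Nontrivial A] (hD : IsChamberCone W C (closure C))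
    {I : Set ℤ} (hI : I.OrdConnected) {x : ℤ → E}
    (hx : ∀ p : ℤ, p - 1 ∈ I → p + 1 ∈ I → x p ∉ segm (x (p - 1)) (x (p + 1)))
    (hlocal : ∀ p : ℤ, p - 1 ∈ I → p + 1 ∈ I → COpposite C F (x p) (x (p - 1)) (x (p + 1)))
    (hsing : ∀ p : ℤ, p - 2 ∈ I → p + 1 ∈ I → SingularSegm W F (x (p - 1)) (x p) →
      COpposite C F (x p) (x (p - 2)) (x (p + 1)))
    {m n : ℤ} (hm : m ∈ I) (hn : n ∈ I) (hmn : m ≤ n) :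
    ∃ f ∈ F, ∃ a : ℤ → A, IsChainIn (closure C) f a x m n := by
  induction n, hmn using Int.leInduction with
  | base =>
    obtain ⟨f, hf, a, b, ha, -⟩ := hE.exists_flat hD (x m) (x m)
    refine ⟨f, hf, fun _ => a, fun p h1 h2 => ?_, fun p h1 h2 => by omega⟩
    rw [le_antisymm h2 h1, ha]
  | succ n hmn ih =>
    have mem : ∀ p, m ≤ p → p ≤ n + 1 → p ∈ I := fun p h1 h2 => hI.out hm hn ⟨h1, h2⟩
    obtain ⟨f, hf, a, h⟩ := ih (mem n hmn (by omega))
    -- A single edge needs no opposition: any two points lie in a flat.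
    rcases hmn.eq_or_lt with rfl | hlt
    · obtain ⟨f, hf, a, b, ha, hb, hab⟩ := hE.exists_flat hD (x m) (x (m + 1))
      refine ⟨f, hf, fun p => if p = m then a else b, fun p h1 h2 => ?_, fun p h1 h2 => ?_⟩
      · rcases (show p = m ∨ p = m + 1 by omega) with rfl | rfl
        · simpa using ha
        · simpa using hb
      · obtain rfl : p = m := by omega
        simpa using hab
    refine h.exists_succ hE hD hf hmn ?_
    have hloc := (hlocal n (mem _ (by omega) (by omega)) (mem _ (by omega) le_rfl)).locallyOpposite
      hE hD
    have e0 := h.1 m le_rfl hmn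
    have e1 := h.1 (n - 1) (by omega) (by omega)
    have e2 := h.1 n hmn le_rfl
    have d1 : a n - a (n - 1) ∈ closure C := h.sub_mem hD (by omega) (by omega) le_rfl
    by_cases hreg : a n - a (n - 1) ∈ C
    · rw [← e0, ← e2]
      rw [← e1, ← e2] at hloc
      exact hloc.of_regular hE hD hf (h.sub_mem hD le_rfl (by omega) (by omega)) hreg
    have hs : IsSingular W (a n - a (n - 1)) := by
      by_contra hs
      exact hreg (hD.regular d1 hs)
    rcases (show n = m + 1 ∨ m ≤ n - 2 by omega) with rfl | hm2
    · simpa using hloc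
    have hloc2 := (hsing n (mem _ hm2 (by omega)) (mem _ (by omega) le_rfl)
      ⟨f, hf, a (n - 1), a n, e1, e2, hs⟩).locallyOpposite hE hD
    have e3 := h.1 (n - 2) hm2 (by omega)
    have d2 : a (n - 1) - a (n - 2) ∈ closure C := h.sub_mem hD hm2 (by omega) (by omega)
    have hadd : (a (n - 1) - a (n - 2)) + (a n - a (n - 1)) = a n - a (n - 2) := by abel
    -- Otherwise both edges are on one ray and `x (n - 1)` is on `[x (n - 2), x n]`, against `hx`.
    have hreg2 : a n - a (n - 2) ∈ C := by
      by_contra hns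
      have hs2 : IsSingular W ((a (n - 1) - a (n - 2)) + (a n - a (n - 1))) := by
        by_contra hs2
        rw [hadd] at hs2
        exact hns (hD.regular (hadd ▸ hD.add_mem d2 d1) hs2)
      obtain ⟨t, ht0, ht1, ht⟩ := hD.singular d2 d1 hs2
      rw [hadd] at ht
      have := hE.lineMap_mem_segm hf (a (n - 2)) (a n) ht0 ht1
      rw [← ht, add_sub_cancel, e1, e2, e3] at this
      refine hx (n - 1) (mem _ (by omega) (by omega)) (mem _ (by omega) (by omega)) ?_
      convert this using 2 <;> congr 1 <;> ring
    rw [← e0, ← e2]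
    rw [← e3, ← e2] at hloc2
    exact hloc2.of_regular hE hD hf (h.sub_mem hD le_rfl hm2 (by omega)) hreg2

/-- The piecewise affine path through the points `a p`. -/
noncomputable def polygonalPath (a : ℤ → A) (t : ℝ) : A :=
  a ⌊t⌋ + Int.fract t • (a (⌊t⌋ + 1) - a ⌊t⌋)

theorem polygonalPath_of_mem_Icc (a : ℤ → A) {p : ℤ} {t : ℝ} (ht : t ∈ Icc (p : ℝ) (p + 1)) :
    polygonalPath a t = a p + (t - p) • (a (p + 1) - a p) := by
  rcases ht.2.lt_or_eq with h | h
  · have hfl : ⌊t⌋ = p := Int.floor_eq_iff.2 ⟨ht.1, h⟩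
    rw [polygonalPath, Int.fract, hfl]
  -- Here the floor jumps to `p + 1`, but both formulas give `a (p + 1)`.
  · have ht' : t = ((p + 1 : ℤ) : ℝ) := by push_cast; exact h
    rw [polygonalPath, ht', Int.floor_intCast, Int.fract_intCast]
    push_cast
    rw [zero_smul, add_zero, add_sub_cancel_left, one_smul, add_sub_cancel]

theorem isPiecewiseAffineOn_polygonalPath (a : ℤ → A) {m n : ℤ} (hmn : m ≤ n) :
    IsPiecewiseAffineOn (polygonalPath a) m n := by
  refine ⟨(n - m).toNat, fun i => m + i, fun i j hij => ?_, by simp, ?_, fun i _ => ?_⟩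
  · have : (i : ℝ) ≤ j := by exact_mod_cast hij
    simpa using this
  · have : ((n - m).toNat : ℤ) = n - m := Int.toNat_of_nonneg (by omega)
    have h2 : ((n - m).toNat : ℝ) = n - m := by exact_mod_cast this
    change (m : ℝ) + ((n - m).toNat : ℝ) = n
    rw [h2]; ring
  · refine ⟨a (m + i) - ((m + i : ℤ) : ℝ) • (a (m + i + 1) - a (m + i)),
      a (m + i + 1) - a (m + i), fun r hr => ?_⟩
    rw [polygonalPath_of_mem_Icc a (p := m + i)]
    · rw [sub_smul]; abel
    · push_cast at hr ⊢
      rwa [add_assoc]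

theorem hasDerivAt_polygonalPath (a : ℤ → A) {t : ℝ} (ht : t ∉ range ((↑) : ℤ → ℝ)) :
    HasDerivAt (polygonalPath a) (a (⌊t⌋ + 1) - a ⌊t⌋) t := by
  have h1 : (⌊t⌋ : ℝ) < t := lt_of_le_of_ne (Int.floor_le t) fun h => ht ⟨_, h⟩
  have h2 : t < ⌊t⌋ + 1 := Int.lt_floor_add_one t
  have hd : HasDerivAt (fun r : ℝ => a ⌊t⌋ + (r - ⌊t⌋) • (a (⌊t⌋ + 1) - a ⌊t⌋))
      ((1 : ℝ) • (a (⌊t⌋ + 1) - a ⌊t⌋)) t :=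
    (((hasDerivAt_id t).sub_const _).smul_const _).const_add _
  rw [one_smul] at hd
  refine hd.congr_of_eventuallyEq ?_
  filter_upwards [Ioo_mem_nhds h1 h2] with r hr
  exact polygonalPath_of_mem_Icc a (Ioo_subset_Icc_self hr)

include hE in
/-- A chain in a marked flat is the sequence of vertices of a `C`-geodesic. -/
theorem IsChainIn.exists_isCGeodesic {f : A → E} (hf : f ∈ F) {a : ℤ → A} {x : ℤ → E} {m n : ℤ}
    (h : IsChainIn (closure C) f a x m n) (hmn : m ≤ n) :
    ∃ γ : ℝ → E, IsPathThrough γ x m n ∧ IsCGeodesic C F γ m n := by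
  refine ⟨f ∘ polygonalPath a, ⟨?_, fun p hp hpn t ht => ?_⟩, f, hf, polygonalPath a,
    isPiecewiseAffineOn_polygonalPath a hmn, fun _ _ => rfl, ?_⟩
  · rw [Function.comp_apply, polygonalPath_of_mem_Icc a (p := m) (by simp), sub_self, zero_smul,
      add_zero]
    exact h.1 m le_rfl hmn
  · have ht' : (p : ℝ) + t ∈ Icc (p : ℝ) (p + 1) := ⟨by linarith [ht.1], by linarith [ht.2]⟩
    rw [Function.comp_apply, polygonalPath_of_mem_Icc a ht', add_sub_cancel_left,
      ← h.1 p hp hpn.le, ← h.1 (p + 1) (by omega) (by omega)]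
    exact hE.dist_lineMap hf _ _ ht.1 ht.2
  · have hcount : ∀ᵐ t ∂(volume : Measure ℝ), t ∉ range ((↑) : ℤ → ℝ) :=
      (countable_range _).ae_notMem _
    filter_upwards [hcount] with t ht htmn
    refine ⟨_, h.2 ⌊t⌋ ?_ ?_, hasDerivAt_polygonalPath a ht⟩
    · exact Int.le_floor.2 htmn.1.le
    · exact Int.floor_lt.2 htmn.2

end Building
end EuclBuilding

theorem mainTheorem6
    {A : Type*} [NormedAddCommGroup A] [InnerProductSpace ℝ A] (hA : Module.finrank ℝ A = 2)
    (W : Subgroup (A ≃ₗᵢ[ℝ] A)) (hW : EuclBuilding.IsFiniteReflectionGroup W)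
    (C : Set A) (hC : EuclBuilding.IsWeylChamber W C)
    {E : Type*} [MetricSpace E] (F : Set (A → E)) (hE : EuclBuilding.IsEuclideanBuilding W F)
    (I : Set ℤ) (hI : I.OrdConnected) (x : ℤ → E)
    (hx : ∀ p : ℤ, p - 1 ∈ I → p + 1 ∈ I → x p ∉ EuclBuilding.segm (x (p - 1)) (x (p + 1)))
    (hlocal : ∀ p : ℤ, p - 1 ∈ I → p + 1 ∈ I →
      EuclBuilding.COpposite C F (x p) (x (p - 1)) (x (p + 1)))
    (hsing : ∀ p : ℤ, p - 2 ∈ I → p + 1 ∈ I → EuclBuilding.SingularSegm W F (x (p - 1)) (x p) →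
      EuclBuilding.COpposite C F (x p) (x (p - 2)) (x (p + 1))) :
    EuclBuilding.IsCGeodesicSeq C F x I := by
  have : Nontrivial A := Module.nontrivial_of_finrank_pos (R := ℝ) (by omega)
  intro m hm n hn hmn
  obtain ⟨f, hf, a, h⟩ := hE.exists_isChainIn (hC.isChamberCone hA hW) hI hx hlocal hsing hm hn hmn
  exact h.exists_isCGeodesic hE hf hmn
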